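/- Let $(R,\mathfrak m,k)$ be a commutative Noetherian local ring and let $C$ be a semidualizing $R$-module, i.e. a finitely generated $R$-module such that the homothety map $R\to\operatorname{Hom}_R(C,C)$ is an isomorphism and $\operatorname{Ext}^i_R(C,C)=0$ for all $i>0$. Over a commutative Noetherian ring, a module is called dualizing if it is semidualizing and has finite injective dimension. A finitely generated $R$-module $G$ is totally $C$-reflexive if the evaluation map $G\to\operatorname{Hom}_R(\operatorname{Hom}_R(G,C),C)$ is an isomorphism and $\operatorname{Ext}^i_R(G,C)=0=\operatorname{Ext}^i_R(\operatorname{Hom}_R(G,C),C)$ for all $i>0$; the dimension $\mathrm{G}_C\text{-}\dim_R(M)$ is the least $n\ge 0$ for which there is an exact sequence $0\to G_n\to\cdots\to G_0\to M\to 0$ with all $G_i$ totally $C$-reflexive, and $\infty$ if there is no such $n$. The type of a finitely generated nonzero $R$-module $M$ of depth $n$ is $r_R(M)=\dim_k\operatorname{Ext}^n_R(k,M)$. A Cohen–Macaulay $R$-module is a nonzero finitely generated $R$-module whose depth equals its Krull dimension. The following are equivalent: (i) $C$ is dualizing. (ii) There exists a proper ideal $\mathfrak a$ of $R$ with $\mathrm{G}_C\text{-}\dim_R(\mathfrak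 aC)<\infty$ such that $C/\mathfrak aC$ is dualizing for $R/\mathfrak a$. (iii) There exists a Cohen–Macaulay $R$-module $M$ with $r_R(M)=1$ and $\mathrm{G}_C\text{-}\dim_R(M)<\infty$. (iv) $r_R(C)=1$ and there exists a Cohen–Macaulay $R$-module $M$ with $\mathrm{G}_C\text{-}\dim_R(M)<\infty$. -/

import Mathlib

universe u

open CategoryTheory CategoryTheory.Abelian

noncomputable section

/-- A finitely generated `R`-module `C` is semidualizing if the homothety map `R → Hom_R(C, C)` is
an isomorphism and `Ext^i_R(C, C) = 0` for all `i > 0`. -/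
structure IsSemidualizing (R : Type u) [CommRing R] (C : Type u) [AddCommGroup C] [Module R C] :
    Prop where
  finite : Module.Finite R C
  homothety_bijective :
    Function.Bijective (LinearMap.lsmul R C : R →ₗ[R] C →ₗ[R] C)
  ext_eq_zero : ∀ i : ℕ, 0 < i → Subsingleton (Ext (ModuleCat.of R C) (ModuleCat.of R C) i)

/-- A dualizing module is a semidualizing module of finite injective dimension. -/
structure IsDualizing (R : Type u) [CommRing R] (C : Type u) [AddCommGroup C] [Module R C] :
    Prop where
  semidualizing : IsSemidualizing R C
  injectiveDimension_lt_top : injectiveDimension (ModuleCat.of R C) < ⊤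

/-- A finitely generated `R`-module `M` is totally `C`-reflexive if the evaluation map
`M → Hom_R(Hom_R(M, C), C)` is an isomorphism and
`Ext^i_R(M, C) = 0 = Ext^i_R(Hom_R(M, C), C)` for all `i > 0`. -/
structure IsTotallyReflexive (R : Type u) [CommRing R] (C : Type u) [AddCommGroup C] [Module R C]
    (M : Type u) [AddCommGroup M] [Module R M] : Prop where
  finite : Module.Finite R M
  evaluation_bijective :
    Function.Bijective (LinearMap.applyₗ : M →ₗ[R] (M →ₗ[R] C) →ₗ[R] C)
  ext_eq_zero : ∀ i : ℕ, 0 < i → Subsingleton (Ext (ModuleCat.of R M) (ModuleCat.of R C) i)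
  ext_hom_eq_zero :
    ∀ i : ℕ, 0 < i → Subsingleton (Ext (ModuleCat.of R (M →ₗ[R] C)) (ModuleCat.of R C) i)

/-- There is an exact sequence `0 → G_n → ⋯ → G_1 → G_0 → M → 0` with every `G_i` totally
`C`-reflexive. The sequence is continued by zero modules in degrees above `n`. -/
def HasGCDimLE (R : Type u) [CommRing R] (C : Type u) [AddCommGroup C] [Module R C]
    (M : Type u) [AddCommGroup M] [Module R M] (n : ℕ) : Prop :=
  ∃ (G : ℕ → ModuleCat.{u} R) (d : ∀ i, G (i + 1) →ₗ[R] G i) (ε : G 0 →ₗ[R] M),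
    (∀ i, i ≤ n → IsTotallyReflexive R C (G i)) ∧
    (∀ i, n < i → Subsingleton (G i)) ∧
    Function.Surjective ε ∧
    Function.Exact (d 0) ε ∧
    ∀ i, Function.Exact (d (i + 1)) (d i)

/-- The `G_C`-dimension of `M`: the least length of a resolution of `M` by totally `C`-reflexive
modules, and `⊤` if there is none. -/
def gcDim (R : Type u) [CommRing R] (C : Type u) [AddCommGroup C] [Module R C]
    (M : Type u) [AddCommGroup M] [Module R M] : ℕ∞ :=
  ⨅ (n : ℕ) (_ : HasGCDimLE R C M n), (n : ℕ∞)

/-- The depth of a module over a local ring: the supremum of the lengths of the `M`-regular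
sequences in the maximal ideal. -/
def moduleDepth (R : Type u) [CommRing R] [IsLocalRing R]
    (M : Type u) [AddCommGroup M] [Module R M] : ℕ∞ :=
  ⨆ (rs : List R) (_ : (∀ r ∈ rs, r ∈ IsLocalRing.maximalIdeal R) ∧
    RingTheory.Sequence.IsRegular M rs), (rs.length : ℕ∞)

/-- A Cohen–Macaulay module over a local ring is a nonzero finitely generated module whose depth
is equal to its Krull dimension. -/
structure IsCohenMacaulayModule (R : Type u) [CommRing R] [IsLocalRing R]
    (M : Type u) [AddCommGroup M] [Module R M] : Prop where
  finite : Module.Finite R M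
  nontrivial : Nontrivial M
  depth_eq_dim : ((moduleDepth R M : ℕ∞) : WithBot ℕ∞) = Module.supportDim R M

/-- `Ext^n_R(k, M)` is annihilated by the maximal ideal. -/
theorem ext_residueField_isTorsionBySet (R : Type u) [CommRing R] [IsLocalRing R]
    (M : Type u) [AddCommGroup M] [Module R M] (n : ℕ) :
    Module.IsTorsionBySet R
      (Ext (ModuleCat.of R (IsLocalRing.ResidueField R)) (ModuleCat.of R M) n)
      (IsLocalRing.maximalIdeal R : Set R) := by
  rintro x ⟨r, hr⟩
  have h0 : r • 𝟙 (ModuleCat.of R (IsLocalRing.ResidueField R)) = 0 := by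
    ext y
    have hy : ∀ z : IsLocalRing.ResidueField R, r • z = 0 := by
      intro z
      have h1 : algebraMap R (IsLocalRing.ResidueField R) r = 0 :=
        (IsLocalRing.residue_eq_zero_iff r).2 hr
      rw [Algebra.smul_def, h1, zero_mul]
    simpa using hy y
  have : r • x = (Ext.mk₀ (r • 𝟙 (ModuleCat.of R (IsLocalRing.ResidueField R)))).comp x
      (zero_add n) := by simp [Ext.mk₀_smul]
  simp [this, h0]

/-- The induced vector space structure on `Ext^n_R(k, M)` over the residue field `k`. -/
abbrev extResidueFieldModule (R : Type u) [CommRing R] [IsLocalRing R]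
    (M : Type u) [AddCommGroup M] [Module R M] (n : ℕ) :
    Module (IsLocalRing.ResidueField R)
      (Ext (ModuleCat.of R (IsLocalRing.ResidueField R)) (ModuleCat.of R M) n) :=
  (ext_residueField_isTorsionBySet R M n).module

/-- The type `r_R(M) = dim_k Ext^n_R(k, M)`, where `n` is the depth of `M` (which is finite for
every finitely generated module over a Noetherian local ring). -/
def moduleType (R : Type u) [CommRing R] [IsLocalRing R]
    (M : Type u) [AddCommGroup M] [Module R M] : ℕ :=
  letI := extResidueFieldModule R M (moduleDepth R M).toNat
  Module.finrank (IsLocalRing.ResidueField R)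
    (Ext (ModuleCat.of R (IsLocalRing.ResidueField R)) (ModuleCat.of R M)
      (moduleDepth R M).toNat)

end

/-! Let t be the depth of C and k the residue field. The core is a duality,
`HasReflexiveResolution.pairing_bijective`: if M has a resolution of length n ≤ t by totally
C-reflexive modules and Ext^i(X, C) = 0 for i < t, then the Yoneda pairing gives Ext^{t-n}(X, M) ≅
Hom(Ext^n(M, C), Ext^t(X, C)). By an Auslander–Buchsbaum argument
(`HasReflexiveResolution.of_depth`) finite G_C-dimension always allows n = t, whence Hom(X, M) ≅
Hom(Ext^t(M, C), Ext^t(X, C)) for X of finite length.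

Dividing a Cohen–Macaulay module by a maximal regular sequence leaves a module of finite length,
keeps the G_C-dimension finite (mapping cones) and turns the type into the length of the socle. So
(iii) and (iv) concern a module M of finite length. For (iii) ⇒ (iv), X = k shows that a socle of
length one in M forces Ext^t(k, C) to have length one. For (iv) ⇒ (i), X = R/m^n with m^n M = 0 puts
M itself on the left, and type one gives length M ≤ length Ext^t(M, C). Since length Ext^t(N, C) ≤
length N for N of finite length, restriction to a maximal submodule N of M is onto in degree t. This
gives Ext^{t+1}(k, C) = 0, then Ext^i(k, C) = 0 for all i > t, so C has finite injective dimension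
(`subsingleton_ext_of_residueField`).

For (ii) ⇒ (iii), a dualizing module D modulo a maximal regular sequence has finite length and a
socle of length one (`IsDualizing.exists_isRegular`); two length counts give r² = 1 for the type r
of D. With D = C/𝔞C this quotient is the required module. For (i) ⇒ (ii) the zero ideal serves. -/

/-! ### Long exact sequences of Ext and their vanishing consequences. -/

section ExtExact

variable {R : Type u} [CommRing R]

lemma LinearMap.length_le_add_of_exact {A B D : Type*} [AddCommGroup A] [Module R A]
    [AddCommGroup B] [Module R B] [AddCommGroup D] [Module R D] {f : A →ₗ[R] B} {g : B →ₗ[R] D}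
    (h : Function.Exact f g) : Module.length R B ≤ Module.length R A + Module.length R D := by
  rw [Module.length_eq_add_of_exact (LinearMap.range f).subtype g.rangeRestrict
    (Submodule.subtype_injective _) g.surjective_rangeRestrict]
  · gcongr
    · exact Module.length_le_of_surjective f.rangeRestrict f.surjective_rangeRestrict
    · exact Module.length_le_of_injective _ (LinearMap.range g).subtype_injective
  · intro x
    have := h x
    simp only [Subtype.ext_iff]
    simpa using this

variable {S : ShortComplex (ModuleCat.{u} R)} (hS : S.ShortExact)

include hS

namespace CategoryTheory.ShortComplex.ShortExact

lemma exact_precomp_g_precomp_f (Y : ModuleCat.{u} R) (n : ℕ) :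
    Function.Exact ((Ext.mk₀ S.g).precompOfLinear R Y (zero_add n))
      ((Ext.mk₀ S.f).precompOfLinear R Y (zero_add n)) :=
  (ShortComplex.ab_exact_iff_function_exact _).1 (Ext.contravariant_sequence_exact₂' hS Y n)

lemma exact_precomp_f_precomp_extClass (Y : ModuleCat.{u} R) (n m : ℕ) (h : 1 + n = m) :
    Function.Exact ((Ext.mk₀ S.f).precompOfLinear R Y (zero_add n))
      (hS.extClass.precompOfLinear R Y h) :=
  (ShortComplex.ab_exact_iff_function_exact _).1 (Ext.contravariant_sequence_exact₁' hS Y n m h)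

lemma exact_precomp_extClass_precomp_g (Y : ModuleCat.{u} R) (n m : ℕ) (h : 1 + n = m) :
    Function.Exact (hS.extClass.precompOfLinear R Y h)
      ((Ext.mk₀ S.g).precompOfLinear R Y (zero_add m)) :=
  (ShortComplex.ab_exact_iff_function_exact _).1 (Ext.contravariant_sequence_exact₃' hS Y n m h)

lemma exact_postcomp_g_postcomp_extClass (X : ModuleCat.{u} R) (n m : ℕ) (h : n + 1 = m) :
    Function.Exact ((Ext.mk₀ S.g).postcompOfLinear R X (add_zero n))
      (hS.extClass.postcompOfLinear R X h) :=
  (ShortComplex.ab_exact_iff_function_exact _).1 (Ext.covariant_sequence_exact₃' X hS n m h)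

lemma exact_postcomp_extClass_postcomp_f (X : ModuleCat.{u} R) (n m : ℕ) (h : n + 1 = m) :
    Function.Exact (hS.extClass.postcompOfLinear R X h)
      ((Ext.mk₀ S.f).postcompOfLinear R X (add_zero m)) :=
  (ShortComplex.ab_exact_iff_function_exact _).1 (Ext.covariant_sequence_exact₁' X hS n m h)

lemma subsingleton_ext_X₂ {Y : ModuleCat.{u} R} {n : ℕ} (h₁ : Subsingleton (Ext S.X₁ Y n))
    (h₃ : Subsingleton (Ext S.X₃ Y n)) : Subsingleton (Ext S.X₂ Y n) := by
  refine subsingleton_of_forall_eq 0 fun x => ?_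
  obtain ⟨y, rfl⟩ := Ext.contravariant_sequence_exact₂ hS Y x (Subsingleton.elim _ _)
  rw [Subsingleton.elim y 0, Ext.comp_zero]

lemma subsingleton_ext_X₃ {Y : ModuleCat.{u} R} {n m : ℕ} (h : 1 + n = m)
    (h₁ : Subsingleton (Ext S.X₁ Y n)) (h₂ : Subsingleton (Ext S.X₂ Y m)) :
    Subsingleton (Ext S.X₃ Y m) := by
  refine subsingleton_of_forall_eq 0 fun x => ?_
  obtain ⟨y, rfl⟩ := Ext.contravariant_sequence_exact₃ hS Y x (Subsingleton.elim _ _) h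
  rw [Subsingleton.elim y 0, Ext.comp_zero]

lemma subsingleton_ext_X₁ {Y : ModuleCat.{u} R} {n m : ℕ} (h : 1 + n = m)
    (h₂ : Subsingleton (Ext S.X₂ Y n)) (h₃ : Subsingleton (Ext S.X₃ Y m)) :
    Subsingleton (Ext S.X₁ Y n) := by
  refine subsingleton_of_forall_eq 0 fun x => ?_
  obtain ⟨y, rfl⟩ := Ext.contravariant_sequence_exact₁ hS Y x h (Subsingleton.elim _ _)
  rw [Subsingleton.elim y 0, Ext.comp_zero]

lemma subsingleton_ext_to_X₁ {X : ModuleCat.{u} R} {n m : ℕ} (h : n + 1 = m)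
    (h₃ : Subsingleton (Ext X S.X₃ n)) (h₂ : Subsingleton (Ext X S.X₂ m)) :
    Subsingleton (Ext X S.X₁ m) := by
  refine subsingleton_of_forall_eq 0 fun x => ?_
  obtain ⟨y, rfl⟩ := Ext.covariant_sequence_exact₁ X hS x (Subsingleton.elim _ _) h
  rw [Subsingleton.elim y 0, Ext.zero_comp]

lemma subsingleton_ext_to_X₃ {X : ModuleCat.{u} R} {n m : ℕ} (h : n + 1 = m)
    (h₂ : Subsingleton (Ext X S.X₂ n)) (h₁ : Subsingleton (Ext X S.X₁ m)) :
    Subsingleton (Ext X S.X₃ n) := by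
  refine subsingleton_of_forall_eq 0 fun x => ?_
  obtain ⟨y, rfl⟩ := Ext.covariant_sequence_exact₃ X hS x h (Subsingleton.elim _ _)
  rw [Subsingleton.elim y 0, Ext.zero_comp]

lemma precomp_g_injective {Y : ModuleCat.{u} R} {n m : ℕ} (h : 1 + n = m)
    (h₁ : Subsingleton (Ext S.X₁ Y n)) :
    Function.Injective ((Ext.mk₀ S.g).precompOfLinear R Y (zero_add m)) := by
  rw [injective_iff_map_eq_zero]
  intro x hx
  obtain ⟨y, rfl⟩ := (hS.exact_precomp_extClass_precomp_g Y n m h x).1 hx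
  rw [Subsingleton.elim y 0, map_zero]

lemma precomp_g_injective_zero (Y : ModuleCat.{u} R) :
    Function.Injective ((Ext.mk₀ S.g).precompOfLinear R Y (zero_add 0)) :=
  have := hS.epi_g
  Ext.precomp_mk₀_injective_of_epi Y S.g

lemma postcomp_f_injective {X : ModuleCat.{u} R} {n m : ℕ} (h : n + 1 = m)
    (h₃ : Subsingleton (Ext X S.X₃ n)) :
    Function.Injective ((Ext.mk₀ S.f).postcompOfLinear R X (add_zero m)) := by
  rw [injective_iff_map_eq_zero]
  intro x hx
  obtain ⟨y, rfl⟩ := (hS.exact_postcomp_extClass_postcomp_f X n m h x).1 hx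
  rw [Subsingleton.elim y 0, map_zero]

lemma postcomp_f_injective_zero (X : ModuleCat.{u} R) :
    Function.Injective ((Ext.mk₀ S.f).postcompOfLinear R X (add_zero 0)) :=
  have := hS.mono_f
  Ext.postcomp_mk₀_injective_of_mono X S.f

lemma precomp_f_surjective {Y : ModuleCat.{u} R} {n m : ℕ} (h : 1 + n = m)
    (h₃ : Subsingleton (Ext S.X₃ Y m)) :
    Function.Surjective ((Ext.mk₀ S.f).precompOfLinear R Y (zero_add n)) := fun x =>
  (hS.exact_precomp_f_precomp_extClass Y n m h x).1 (Subsingleton.elim _ _)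

end CategoryTheory.ShortComplex.ShortExact

end ExtExact

/-! ### Short exact sequences of linear maps; Ext and linear equivalences. -/

section ShortExactSequences

variable {R : Type u} [CommRing R]

/-- The short complex `A → B → D` attached to an exact pair of linear maps. -/
abbrev Function.Exact.shortComplex {A B D : Type u} [AddCommGroup A] [Module R A]
    [AddCommGroup B] [Module R B] [AddCommGroup D] [Module R D] {f : A →ₗ[R] B} {g : B →ₗ[R] D}
    (h : Function.Exact f g) : ShortComplex (ModuleCat.{u} R) :=
  ShortComplex.mk (ModuleCat.ofHom f) (ModuleCat.ofHom g)
    (by rw [← ModuleCat.ofHom_comp, h.linearMap_comp_eq_zero]; rfl)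

lemma Function.Exact.shortExact {A B D : Type u} [AddCommGroup A] [Module R A]
    [AddCommGroup B] [Module R B] [AddCommGroup D] [Module R D] {f : A →ₗ[R] B} {g : B →ₗ[R] D}
    (h : Function.Exact f g) (hf : Function.Injective f) (hg : Function.Surjective g) :
    h.shortComplex.ShortExact :=
  ModuleCat.shortComplex_shortExact _ h hf hg

/-- `0 → N → M → M ⧸ N → 0` -/
lemma Submodule.shortExact {M : Type u} [AddCommGroup M] [Module R M] (N : Submodule R M) :
    (LinearMap.exact_subtype_mkQ N).shortComplex.ShortExact :=
  Function.Exact.shortExact _ N.injective_subtype N.mkQ_surjective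

/-- Precomposition with a linear equivalence. -/
noncomputable def Ext.congrLeft {A B : Type u} [AddCommGroup A] [Module R A]
    [AddCommGroup B] [Module R B] (e : A ≃ₗ[R] B) (Y : ModuleCat.{u} R) (n : ℕ) :
    Ext (ModuleCat.of R B) Y n ≃ₗ[R] Ext (ModuleCat.of R A) Y n :=
  LinearEquiv.ofLinearMap ((Ext.mk₀ (ModuleCat.ofHom e.toLinearMap)).precompOfLinear R Y (zero_add n))
    ((Ext.mk₀ (ModuleCat.ofHom e.symm.toLinearMap)).precompOfLinear R Y (zero_add n))
    (by ext x; simp [← ModuleCat.ofHom_comp])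
    (by ext x; simp [← ModuleCat.ofHom_comp])

/-- Postcomposition with a linear equivalence. -/
noncomputable def Ext.congrRight {A B : Type u} [AddCommGroup A] [Module R A]
    [AddCommGroup B] [Module R B] (X : ModuleCat.{u} R) (e : A ≃ₗ[R] B) (n : ℕ) :
    Ext X (ModuleCat.of R A) n ≃ₗ[R] Ext X (ModuleCat.of R B) n :=
  LinearEquiv.ofLinearMap ((Ext.mk₀ (ModuleCat.ofHom e.toLinearMap)).postcompOfLinear R X (add_zero n))
    ((Ext.mk₀ (ModuleCat.ofHom e.symm.toLinearMap)).postcompOfLinear R X (add_zero n))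
    (by ext x; simp [← ModuleCat.ofHom_comp])
    (by ext x; simp [← ModuleCat.ofHom_comp])

/-- `Ext⁰` is `Hom`. -/
noncomputable def Ext.zeroEquivLinearMap (A B : Type u) [AddCommGroup A] [Module R A]
    [AddCommGroup B] [Module R B] :
    Ext (ModuleCat.of R A) (ModuleCat.of R B) 0 ≃ₗ[R] (A →ₗ[R] B) :=
  Ext.linearEquiv₀.trans ModuleCat.homLinearEquiv

lemma Ext.subsingleton_of_subsingleton_left (X Y : ModuleCat.{u} R) [Subsingleton X] (n : ℕ) :
    Subsingleton (Ext X Y n) := by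
  have : Projective X := (ModuleCat.isZero_of_subsingleton X).projective
  refine subsingleton_of_forall_eq 0 fun x => ?_
  rw [← Ext.mk₀_id_comp x, (ModuleCat.isZero_of_subsingleton X).eq_of_src (𝟙 X) 0, Ext.mk₀_zero,
    Ext.zero_comp]

lemma Ext.smul_eq_zero_of_smul_left_eq_zero {X Y : ModuleCat.{u} R} {r : R}
    (h : ∀ x : X, r • x = 0) {n : ℕ} (e : Ext X Y n) : r • e = 0 := by
  have h0 : r • 𝟙 X = 0 := by
    ext y
    exact h y
  have : r • e = (Ext.mk₀ (r • 𝟙 X)).comp e (zero_add n) := by simp [Ext.mk₀_smul]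
  rw [this, h0, Ext.mk₀_zero, Ext.zero_comp]

end ShortExactSequences

/-! ### Ext over a local ring, controlled by the residue field. -/

section LocalExt

open IsLocalRing

variable {R : Type u} [CommRing R] [IsLocalRing R]

lemma IsLocalRing.nonempty_equiv_residueField (M : Type*) [AddCommGroup M] [Module R M]
    [IsSimpleModule R M] : Nonempty (M ≃ₗ[R] ResidueField R) := by
  obtain ⟨I, hI, ⟨e⟩⟩ := isSimpleModule_iff_quot_maximal.1 (inferInstance : IsSimpleModule R M)
  obtain rfl := eq_maximalIdeal hI
  exact ⟨e⟩

instance IsLocalRing.isSimpleModule_residueField : IsSimpleModule R (ResidueField R) :=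
  isSimpleModule_iff_quot_maximal.2 ⟨maximalIdeal R, inferInstance, ⟨LinearEquiv.refl R _⟩⟩

/-- Induction on modules of finite length, by extensions with quotient the residue field. -/
lemma IsFiniteLength.induction_residueField {P : ModuleCat.{u} R → Prop}
    (zero : ∀ M : ModuleCat.{u} R, Subsingleton M → P M)
    (step : ∀ (M : ModuleCat.{u} R) (N : Submodule R M) (_ : (M ⧸ N) ≃ₗ[R] ResidueField R),
      IsFiniteLength R N → P (ModuleCat.of R N) → P M)
    {M : ModuleCat.{u} R} (h : IsFiniteLength R M) : P M := by
  suffices H : ∀ (M : Type u) [AddCommGroup M] [Module R M], IsFiniteLength R M →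
      P (ModuleCat.of R M) from H M h
  intro M _ _ h
  induction h with
  | of_subsingleton => exact zero _ ‹_›
  | @of_simple_quotient M _ _ N _ hN ih =>
    obtain ⟨e⟩ := nonempty_equiv_residueField (R := R) (M ⧸ N)
    exact step (ModuleCat.of R M) N e hN ih

lemma IsFiniteLength.subsingleton_ext {X Y : ModuleCat.{u} R} {n : ℕ} (hX : IsFiniteLength R X)
    (h : Subsingleton (Ext (ModuleCat.of R (ResidueField R)) Y n)) : Subsingleton (Ext X Y n) := by
  refine IsFiniteLength.induction_residueField (P := fun X => Subsingleton (Ext X Y n))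
    (fun M hM => ?_) (fun M N e hN ih => ?_) hX
  · exact Ext.subsingleton_of_subsingleton_left M Y n
  · exact N.shortExact.subsingleton_ext_X₂ ih (Ext.congrLeft e Y n).symm.subsingleton

lemma Module.length_submodule_add_one {M : Type*} [AddCommGroup M] [Module R M]
    {N : Submodule R M} (e : (M ⧸ N) ≃ₗ[R] ResidueField R) :
    Module.length R M = Module.length R N + 1 := by
  rw [Module.length_eq_add_of_exact N.subtype N.mkQ N.injective_subtype N.mkQ_surjective
    (LinearMap.exact_subtype_mkQ N), e.length_eq,
    Module.length_eq_one R (ResidueField R)]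

/-- Half-exactness of Ext^n makes its length subadditive along a composition series, all of whose
factors are k. -/
lemma IsFiniteLength.length_ext_le {X Y : ModuleCat.{u} R} (hX : IsFiniteLength R X) (n : ℕ) :
    Module.length R (Ext X Y n) ≤
      Module.length R X * Module.length R (Ext (ModuleCat.of R (ResidueField R)) Y n) := by
  refine IsFiniteLength.induction_residueField (P := fun X => Module.length R (Ext X Y n) ≤
      Module.length R X * Module.length R (Ext (ModuleCat.of R (ResidueField R)) Y n))
    (fun M hM => ?_) (fun M N e hN ih => ?_) hX
  · have := Ext.subsingleton_of_subsingleton_left M Y n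
    simp
  · refine (LinearMap.length_le_add_of_exact (N.shortExact.exact_precomp_g_precomp_f Y n)).trans ?_
    rw [Module.length_submodule_add_one e, add_mul, one_mul, add_comm]
    exact add_le_add ih (Ext.congrLeft e Y n).symm.length_eq.le

/-- Below degree n all Ext from modules of finite length vanish, so Ext^n(-, Y) behaves like Hom: it
is left exact. Degree 0 has no preceding term and is treated apart. -/
lemma CategoryTheory.ShortComplex.ShortExact.precomp_g_injective_of_lt
    {S : ShortComplex (ModuleCat.{u} R)} (hS : S.ShortExact) {Y : ModuleCat.{u} R} {n : ℕ}
    (hX : IsFiniteLength R S.X₁)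
    (h : ∀ i < n, Subsingleton (Ext (ModuleCat.of R (ResidueField R)) Y i)) :
    Function.Injective ((Ext.mk₀ S.g).precompOfLinear R Y (zero_add n)) := by
  cases n with
  | zero => exact hS.precomp_g_injective_zero Y
  | succ n => exact hS.precomp_g_injective (add_comm 1 n) (hX.subsingleton_ext (h n (by omega)))

/-- If only the n-th of the groups Ext^i(k, Y), i ≤ n + 1, survives, Ext^n(-, Y) is exact on modules
of finite length, so length is additive. -/
lemma IsFiniteLength.length_ext_eq {X Y : ModuleCat.{u} R} (hX : IsFiniteLength R X) {n : ℕ}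
    (h : ∀ i < n, Subsingleton (Ext (ModuleCat.of R (ResidueField R)) Y i))
    (h' : Subsingleton (Ext (ModuleCat.of R (ResidueField R)) Y (n + 1))) :
    Module.length R (Ext X Y n) =
      Module.length R X * Module.length R (Ext (ModuleCat.of R (ResidueField R)) Y n) := by
  refine IsFiniteLength.induction_residueField (P := fun X => Module.length R (Ext X Y n) =
      Module.length R X * Module.length R (Ext (ModuleCat.of R (ResidueField R)) Y n))
    (fun M hM => ?_) (fun M N e hN ih => ?_) hX
  · have := Ext.subsingleton_of_subsingleton_left M Y n
    simp
  · rw [Module.length_eq_add_of_exact _ _ (N.shortExact.precomp_g_injective_of_lt hN h)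
      (N.shortExact.precomp_f_surjective (add_comm 1 n) (Ext.congrLeft e Y _).symm.subsingleton)
      (N.shortExact.exact_precomp_g_precomp_f Y n)]
    rw [Module.length_submodule_add_one e, add_mul, one_mul, add_comm]
    exact congr_arg₂ (· + ·) ih (Ext.congrLeft e Y n).symm.length_eq

lemma IsFiniteLength.length_linearMap_le {E W : Type u} [AddCommGroup E] [Module R E]
    [AddCommGroup W] [Module R W] (hE : IsFiniteLength R E) :
    Module.length R (E →ₗ[R] W) ≤ Module.length R E * Module.length R (ResidueField R →ₗ[R] W) := by
  rw [← (Ext.zeroEquivLinearMap E W).length_eq,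
    ← (Ext.zeroEquivLinearMap (ResidueField R) W).length_eq]
  exact IsFiniteLength.length_ext_le (X := ModuleCat.of R E) (Y := ModuleCat.of R W) hE 0

/-- The vanishing of `Ext^i(k, Y)` for `i ≥ n` implies that of `Ext^i(X, Y)` for all finitely
generated modules `X`. -/
lemma subsingleton_ext_of_residueField [IsNoetherianRing R] {Y : ModuleCat.{u} R}
    [Module.Finite R Y] {n : ℕ}
    (h : ∀ i, n ≤ i → Subsingleton (Ext (ModuleCat.of R (ResidueField R)) Y i))
    (X : ModuleCat.{u} R) [Module.Finite R X] (i : ℕ) (hi : n ≤ i) : Subsingleton (Ext X Y i) := by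
  have key (I : Ideal R) : ∀ i, n ≤ i → Subsingleton (Ext (ModuleCat.of R (R ⧸ I)) Y i) := by
    induction I using IsNoetherian.induction with
    | hgt I ih =>
    intro i hi
    by_cases hIm : I = maximalIdeal R
    · subst hIm
      exact h i hi
    by_cases hI : I = ⊤
    · have : Subsingleton (R ⧸ I) := Ideal.Quotient.subsingleton_iff.2 hI
      exact Ext.subsingleton_of_subsingleton_left _ _ _
    -- The sequence 0 → R/(I : x) → R/I → R/(I + (x)) → 0 reduces I to strictly larger ideals unless
    -- (I : x) = I.
    obtain ⟨x, hx, hxI⟩ := SetLike.exists_of_lt (lt_of_le_of_ne (le_maximalIdeal hI) hIm)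
    -- `J = (I : x)`
    let f : R →ₗ[R] R ⧸ I := LinearMap.toSpanSingleton R (R ⧸ I) (Ideal.Quotient.mk I x)
    have hf (a : R) : f a = Ideal.Quotient.mk I (a * x) := by
      simp [f, Algebra.smul_def]
    have hker (a : R) : a ∈ LinearMap.ker f ↔ a * x ∈ I := by
      rw [LinearMap.mem_ker, hf, Ideal.Quotient.eq_zero_iff_mem]
    have hle : I ≤ LinearMap.ker f := fun a ha => (hker a).2 (Ideal.mul_mem_right x I ha)
    let g : (R ⧸ I) →ₗ[R] R ⧸ (I ⊔ Ideal.span {x}) := Submodule.mapQ _ _ LinearMap.id le_sup_left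
    have hg : Function.Surjective g := fun y => by
      obtain ⟨y, rfl⟩ := Submodule.mkQ_surjective _ y
      exact ⟨Submodule.Quotient.mk y, rfl⟩
    have hgt : I < I ⊔ Ideal.span {x} :=
      lt_of_le_of_ne le_sup_left fun e =>
        hxI (e ▸ Ideal.mem_sup_right (Ideal.mem_span_singleton_self x))
    let f' : (R ⧸ LinearMap.ker f) →ₗ[R] R ⧸ I := (LinearMap.ker f).liftQ f le_rfl
    have hf' : Function.Injective f' := LinearMap.ker_eq_bot.1 (Submodule.ker_liftQ_eq_bot _ _ _ le_rfl)
    have hfg : Function.Exact f' g := by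
      intro y
      obtain ⟨y, rfl⟩ := Submodule.mkQ_surjective _ y
      change Submodule.Quotient.mk y = 0 ↔ _
      rw [Submodule.Quotient.mk_eq_zero, Submodule.mem_sup]
      constructor
      · rintro ⟨a, ha, b, hb, rfl⟩
        obtain ⟨c, rfl⟩ := Ideal.mem_span_singleton'.1 hb
        refine ⟨Submodule.Quotient.mk c, ?_⟩
        change f c = Ideal.Quotient.mk I (a + c * x)
        rw [hf, map_add, Ideal.Quotient.eq_zero_iff_mem.2 ha, zero_add]
      · rintro ⟨c, hc⟩
        obtain ⟨c, rfl⟩ := Submodule.mkQ_surjective _ c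
        change f c = Ideal.Quotient.mk I y at hc
        rw [hf] at hc
        refine ⟨y - c * x, ?_, c * x, Ideal.mem_span_singleton'.2 ⟨c, rfl⟩, by ring⟩
        rw [← Ideal.Quotient.eq, hc]
    have hS := hfg.shortExact hf' hg
    -- When (I : x) = I, the first map is multiplication by x on R/I. As Ext^{i+1}(R/(I + (x)), Y) =
    -- 0, x acts surjectively on the finitely generated module Ext^i(R/I, Y), which vanishes by
    -- Nakayama.
    by_cases hp : LinearMap.ker f = I
    · let e : (R ⧸ I) ≃ₗ[R] (R ⧸ LinearMap.ker f) := Submodule.quotEquivOfEq _ _ hp.symm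
      have hcomp : f' ∘ₗ e.toLinearMap = x • LinearMap.id := by
        refine Submodule.linearMap_qext _ (LinearMap.ext fun a => ?_)
        change f a = x • Ideal.Quotient.mk I a
        rw [hf, Algebra.smul_def, mul_comm, map_mul]
        rfl
      have hsurj : Function.Surjective (LinearMap.lsmul R (Ext (ModuleCat.of R (R ⧸ I)) Y i) x) := by
        have h1 := (Ext.congrLeft e Y i).surjective.comp
          (hS.precomp_f_surjective (add_comm 1 i) (ih _ hgt (i + 1) (by omega)))
        intro z
        obtain ⟨w, hw⟩ := h1 z
        refine ⟨w, Eq.trans ?_ hw⟩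
        have : (Ext.congrLeft e Y i) ((Ext.mk₀ (ModuleCat.ofHom f')).comp w (zero_add i)) =
            (Ext.mk₀ (ModuleCat.ofHom (f' ∘ₗ e.toLinearMap))).comp w (zero_add i) := by
          simp [Ext.congrLeft, ModuleCat.ofHom_comp]
        refine Eq.trans ?_ this.symm
        rw [hcomp]
        have h2 : ModuleCat.ofHom (x • (LinearMap.id : (R ⧸ I) →ₗ[R] R ⧸ I)) =
          x • 𝟙 (ModuleCat.of R (R ⧸ I)) := rfl
        rw [h2, Ext.mk₀_smul, Ext.smul_comp, Ext.mk₀_id_comp]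
        rfl
      have htop : (⊤ : Submodule R (Ext (ModuleCat.of R (R ⧸ I)) Y i)) ≤
          Ideal.span {x} • (⊤ : Submodule R (Ext (ModuleCat.of R (R ⧸ I)) Y i)) := by
        intro z _
        obtain ⟨w, rfl⟩ := hsurj z
        exact Submodule.smul_mem_smul (Ideal.mem_span_singleton_self x) trivial
      have := Submodule.eq_bot_of_le_smul_of_le_jacobson_bot (Ideal.span {x}) ⊤
        Module.Finite.fg_top htop
        (((Ideal.span_singleton_le_iff_mem _).2 hx).trans
          (maximalIdeal_le_jacobson ⊥))
      exact (Submodule.subsingleton_iff R).1 (subsingleton_of_bot_eq_top this.symm)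
    · exact hS.subsingleton_ext_X₂ (ih _ (lt_of_le_of_ne hle (Ne.symm hp)) i hi) (ih _ hgt i hi)
  suffices H : ∀ (X : Type u) [AddCommGroup X] [Module R X] [Module.Finite R X],
      Subsingleton (Ext (ModuleCat.of R X) Y i) from H X
  intro X _ _ hX
  induction hX using IsNoetherianRing.induction_on_isQuotientEquivQuotientPrime R with
  | subsingleton N => exact Ext.subsingleton_of_subsingleton_left _ _ _
  | quotient N p f => exact (Ext.congrLeft f Y i).symm.subsingleton_congr.2 (key p.1 i hi)
  | exact N₁ N₂ N₃ f g hf hg hfg h₁ h₃ => exact (hfg.shortExact hf hg).subsingleton_ext_X₂ h₁ h₃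

/-- A module `Y` with `Ext^n(X, Y) = 0` for all finitely generated `X` has injective dimension
less than `n`. -/
lemma hasInjectiveDimensionLT_of_forall_finite {R : Type u} [CommRing R] (n : ℕ)
    (Y : ModuleCat.{u} R)
    (h : ∀ (X : ModuleCat.{u} R) [Module.Finite R X], Subsingleton (Ext X Y (n + 1))) :
    HasInjectiveDimensionLT Y (n + 1) := by
  induction n generalizing Y with
  | zero =>
    -- Baer's criterion: Ext¹(R/I, Y) = 0 extends every map I → Y to R. The inductive step passes to
    -- the cokernel of an injective hull-type embedding Y → J with J injective.
    rw [← injective_iff_hasInjectiveDimensionLT_one, ← Module.injective_iff_injective_object R Y,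
      ← Module.Baer.iff_injective]
    intro I g
    obtain ⟨x, hx⟩ := (Submodule.shortExact (M := R) I).precomp_f_surjective
      (add_comm 1 0) (h (ModuleCat.of R (R ⧸ I))) (Ext.mk₀ (ModuleCat.ofHom g : _ ⟶ Y))
    obtain ⟨y, rfl⟩ := Ext.addEquiv₀.symm.surjective x
    refine ⟨y.hom, fun x hx' => ?_⟩
    have h1 : ModuleCat.ofHom I.subtype ≫ y = ModuleCat.ofHom g := by
      apply Ext.addEquiv₀.symm.injective
      simpa using hx
    exact congr($h1 ⟨x, hx'⟩)
  | succ n ih =>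
    let P : InjectivePresentation Y := Classical.arbitrary _
    have hS : (ShortComplex.mk _ _ (Limits.cokernel.condition P.f)).ShortExact :=
      { exact := ShortComplex.exact_cokernel P.f }
    refine hS.hasInjectiveDimensionLT_X₁ _ (ih _ fun X _ => ?_) ?_
    · exact hS.subsingleton_ext_to_X₃ rfl (Ext.subsingleton_of_injective X P.J n) (h X)
    · exact inferInstanceAs (HasInjectiveDimensionLT P.J (n + 2))

end LocalExt

/-! ### Regular sequences, depth and type in terms of Ext. -/

section RegularSequences

open IsLocalRing RingTheory.Sequence

variable {R : Type u} [CommRing R]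

section

open Pointwise

/-- If `x` is `M`-regular and kills `X`, then `Ext^{n+1}(X, M) ≅ Ext^n(X, M / xM)` as soon as
`Ext^n(X, M) = 0`. -/
lemma IsSMulRegular.nonempty_ext_equiv {M : ModuleCat.{u} R} {x : R} (hx : IsSMulRegular M x)
    {X : ModuleCat.{u} R} (hX : ∀ z : X, x • z = 0) {n : ℕ} (h : Subsingleton (Ext X M n)) :
    Nonempty (Ext X (ModuleCat.of R (QuotSMulTop x M)) n ≃ₗ[R] Ext X M (n + 1)) := by
  have hS := hx.smulShortComplex_shortExact
  refine ⟨LinearEquiv.ofBijective (hS.extClass.postcompOfLinear R X rfl) ⟨?_, fun z => ?_⟩⟩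
  · rw [injective_iff_map_eq_zero]
    intro z hz
    obtain ⟨y, rfl⟩ := (hS.exact_postcomp_g_postcomp_extClass X n _ rfl z).1 hz
    have : y = 0 := h.elim _ _
    rw [this, map_zero]
  · refine (hS.exact_postcomp_extClass_postcomp_f X n _ rfl z).1 ?_
    have key (w : Ext X M (n + 1)) : w.comp (Ext.mk₀ (x • 𝟙 M)) (add_zero (n + 1)) = 0 := by
      rw [Ext.mk₀_smul, Ext.comp_smul, Ext.comp_mk₀_id]
      exact Ext.smul_eq_zero_of_smul_left_eq_zero hX w
    exact key z

lemma IsSMulRegular.subsingleton_linearMap {M X : Type*} [AddCommGroup M] [Module R M]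
    [AddCommGroup X] [Module R X] {x : R} (hx : IsSMulRegular M x) (hX : ∀ z : X, x • z = 0) :
    Subsingleton (X →ₗ[R] M) := by
  refine subsingleton_of_forall_eq 0 fun f => LinearMap.ext fun z => hx ?_
  change x • f z = x • (0 : M)
  rw [← map_smul, hX, map_zero, smul_zero]

/-- If the `M`-regular sequence `rs` kills `X`, then `Ext^i(X, M)` vanishes for `i < length rs` and
is `Hom(X, M / rs M)` for `i = length rs`. -/
lemma RingTheory.Sequence.IsWeaklyRegular.ext_eq (X : Type u) [AddCommGroup X] [Module R X]
    (rs : List R) (hX : ∀ r ∈ rs, ∀ z : X, r • z = 0) (M : Type u) [AddCommGroup M] [Module R M]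
    (h : IsWeaklyRegular M rs) :
    (∀ i < rs.length, Subsingleton (Ext (ModuleCat.of R X) (ModuleCat.of R M) i)) ∧
      Nonempty (Ext (ModuleCat.of R X) (ModuleCat.of R M) rs.length ≃ₗ[R]
        (X →ₗ[R] M ⧸ (Ideal.ofList rs • ⊤ : Submodule R M))) := by
  induction rs generalizing M with
  | nil =>
    refine ⟨by simp, ⟨(Ext.zeroEquivLinearMap X M).trans (LinearEquiv.congrRight ?_)⟩⟩
    exact (Submodule.quotEquivOfEqBot _ (by simp)).symm
  | cons r rs ih =>
    rw [isWeaklyRegular_cons_iff] at h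
    simp only [List.mem_cons, forall_eq_or_imp] at hX
    obtain ⟨h1, ⟨e⟩⟩ := ih hX.2 (QuotSMulTop r M) h.2
    have h2 : ∀ i < rs.length + 1, Subsingleton (Ext (ModuleCat.of R X) (ModuleCat.of R M) i) := by
      intro i
      induction i with
      | zero =>
        have := IsSMulRegular.subsingleton_linearMap (X := X) h.1 hX.1
        exact fun _ => (Ext.zeroEquivLinearMap X M).subsingleton
      | succ i ihi =>
        intro hi
        obtain ⟨e'⟩ := IsSMulRegular.nonempty_ext_equiv (M := ModuleCat.of R M)
          (X := ModuleCat.of R X) h.1 hX.1 (ihi (by omega))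
        have := h1 i (by omega)
        exact e'.symm.subsingleton
    obtain ⟨e'⟩ := IsSMulRegular.nonempty_ext_equiv (M := ModuleCat.of R M)
      (X := ModuleCat.of R X) h.1 hX.1 (h2 rs.length (by omega))
    exact ⟨h2, ⟨e'.symm.trans (e.trans (LinearEquiv.congrRight
      (Submodule.quotOfListConsSMulTopEquivQuotSMulTopInner M r rs).symm))⟩⟩

/-- `N / x N` has one more possibly nonzero `Ext` than `N`, if `x` is `N`-regular. -/
lemma RingTheory.Sequence.IsWeaklyRegular.ext_quotient_eq (Y : ModuleCat.{u} R) (rs : List R)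
    (N : Type u) [AddCommGroup N] [Module R N] (h : IsWeaklyRegular N rs)
    (Q : Type u) [AddCommGroup Q] [Module R Q] (s : ℕ) (e : Ext (ModuleCat.of R N) Y s ≃ₗ[R] Q)
    (hs : ∀ i, s < i → Subsingleton (Ext (ModuleCat.of R N) Y i)) :
    (∀ i, s + rs.length < i → Subsingleton
      (Ext (ModuleCat.of R (N ⧸ (Ideal.ofList rs • ⊤ : Submodule R N))) Y i)) ∧
      Nonempty (Ext (ModuleCat.of R (N ⧸ (Ideal.ofList rs • ⊤ : Submodule R N))) Y
        (s + rs.length) ≃ₗ[R] Q ⧸ (Ideal.ofList rs • ⊤ : Submodule R Q)) := by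
  induction rs generalizing N Q s with
  | nil =>
    have e' : (N ⧸ (Ideal.ofList ([] : List R) • ⊤ : Submodule R N)) ≃ₗ[R] N :=
      Submodule.quotEquivOfEqBot (Ideal.ofList ([] : List R) • ⊤ : Submodule R N)
        (by rw [Ideal.ofList_nil, Submodule.bot_smul])
    have e'' : (Q ⧸ (Ideal.ofList ([] : List R) • ⊤ : Submodule R Q)) ≃ₗ[R] Q :=
      Submodule.quotEquivOfEqBot (Ideal.ofList ([] : List R) • ⊤ : Submodule R Q)
        (by rw [Ideal.ofList_nil, Submodule.bot_smul])
    refine ⟨fun i hi => ?_, ⟨(Ext.congrLeft e' Y s).symm.trans (e.trans e''.symm)⟩⟩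
    have := hs i hi
    exact (Ext.congrLeft e' Y i).symm.subsingleton
  | cons r rs ih =>
    rw [isWeaklyRegular_cons_iff] at h
    have hS := IsSMulRegular.smulShortComplex_shortExact (M := ModuleCat.of R N) h.1
    let f : Ext (ModuleCat.of R N) Y s →ₗ[R]
      Ext (ModuleCat.of R (QuotSMulTop r N)) Y (s + 1) :=
        hS.extClass.precompOfLinear R Y (add_comm 1 s)
    have hf : Function.Surjective f := fun z =>
      (hS.exact_precomp_extClass_precomp_g Y s _ (add_comm 1 s) z).1
        ((hs (s + 1) (by omega)).elim _ _)
    have hker : LinearMap.ker f = r • (⊤ : Submodule R (Ext (ModuleCat.of R N) Y s)) := by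
      ext z
      rw [LinearMap.mem_ker]
      refine (hS.exact_precomp_f_precomp_extClass Y s _ (add_comm 1 s) z).trans ?_
      rw [Submodule.mem_smul_pointwise_iff_exists]
      have key (w : Ext (ModuleCat.of R N) Y s) :
          (Ext.mk₀ (r • 𝟙 (ModuleCat.of R N))).comp w (zero_add s) = r • w := by
        rw [Ext.mk₀_smul, Ext.smul_comp, Ext.mk₀_id_comp]
      exact exists_congr fun y => ⟨fun hy => ⟨trivial, (key y).symm.trans hy⟩,
        fun hy => (key y).trans hy.2⟩
    have e1 : Ext (ModuleCat.of R (QuotSMulTop r N)) Y (s + 1) ≃ₗ[R] QuotSMulTop r Q :=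
      (f.quotKerEquivOfSurjective hf).symm.trans
        ((Submodule.quotEquivOfEq _ _ hker).trans (QuotSMulTop.congr r e))
    obtain ⟨h1, ⟨e2⟩⟩ := ih (QuotSMulTop r N) h.2 (QuotSMulTop r Q) (s + 1) e1 fun i hi => by
      obtain ⟨i, rfl⟩ : ∃ j, i = 1 + j := ⟨i - 1, by omega⟩
      exact hS.subsingleton_ext_X₃ rfl (hs i (by omega)) (hs (1 + i) (by omega))
    have hlen : s + (r :: rs).length = s + 1 + rs.length := by simp; omega
    have e3 := Submodule.quotOfListConsSMulTopEquivQuotSMulTopInner N r rs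
    rw [hlen]
    refine ⟨fun i hi => ?_, ⟨(Ext.congrLeft e3 Y _).symm.trans (e2.trans
      (Submodule.quotOfListConsSMulTopEquivQuotSMulTopInner Q r rs).symm)⟩⟩
    have := h1 i hi
    exact (Ext.congrLeft e3 Y i).symm.subsingleton

end

variable [IsLocalRing R]

lemma IsFiniteLength.exists_pow_smul_eq_zero {M : ModuleCat.{u} R} (h : IsFiniteLength R M) :
    ∃ n : ℕ, maximalIdeal R ^ n ≤ Module.annihilator R M := by
  refine IsFiniteLength.induction_residueField
    (P := fun M => ∃ n : ℕ, maximalIdeal R ^ n ≤ Module.annihilator R M) ?_ ?_ h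
  · intro M hM
    exact ⟨0, by rw [Module.annihilator_eq_top_iff.2 hM]; exact le_top⟩
  · rintro M N e - ⟨n, hn⟩
    refine ⟨n + 1, ?_⟩
    rw [pow_succ, Ideal.mul_le]
    intro a ha b hb
    rw [Module.mem_annihilator]
    intro m
    have hbm : b • m ∈ N := by
      rw [← Submodule.Quotient.mk_eq_zero, Submodule.Quotient.mk_smul]
      apply e.injective
      rw [map_smul, map_zero, Algebra.smul_def,
        show algebraMap R (ResidueField R) b = 0 from (residue_eq_zero_iff b).2 hb, zero_mul]
    have := Module.mem_annihilator.1 (hn ha) ⟨b • m, hbm⟩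
    rw [mul_smul]
    exact congrArg Subtype.val this

/-- In a prime filtration each factor R/p has p in the support, so p is maximal and the factor is
simple. -/
lemma isFiniteLength_of_support_subset [IsNoetherianRing R] (M : Type u) [AddCommGroup M]
    [Module R M] [hM : Module.Finite R M] (h : Module.support R M ⊆ {closedPoint R}) :
    IsFiniteLength R M := by
  induction hM using IsNoetherianRing.induction_on_isQuotientEquivQuotientPrime R with
  | subsingleton N => exact .of_subsingleton
  | quotient N p f =>
    have hp : p ∈ Module.support R N := by
      rw [f.support_eq, Module.support_eq_zeroLocus, Ideal.annihilator_quotient]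
      exact le_rfl (a := p.asIdeal)
    have : p.asIdeal = maximalIdeal R := by
      rw [Set.mem_singleton_iff.1 (h hp)]
      rfl
    have : IsSimpleModule R N := isSimpleModule_iff_quot_maximal.2
      ⟨p.asIdeal, this ▸ inferInstance, ⟨f⟩⟩
    exact Module.length_ne_top_iff.1 (by rw [Module.length_eq_one R N]; exact ENat.one_ne_top)
  | exact N₁ N₂ N₃ f g hf hg hfg h₁ h₃ =>
    rw [← Module.length_ne_top_iff, Module.length_eq_add_of_exact f g hf hg hfg]
    exact WithTop.add_ne_top.2 ⟨Module.length_ne_top_iff.2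
      (h₁ ((Module.support_subset_of_injective f hf).trans h)), Module.length_ne_top_iff.2
      (h₃ ((Module.support_subset_of_surjective g hg).trans h))⟩

lemma isFiniteLength_of_pow_le_annihilator [IsNoetherianRing R] (M : Type u) [AddCommGroup M]
    [Module R M] [Module.Finite R M] (n : ℕ) (h : maximalIdeal R ^ n ≤ Module.annihilator R M) :
    IsFiniteLength R M := by
  refine isFiniteLength_of_support_subset M fun p hp => ?_
  rw [Module.support_eq_zeroLocus, PrimeSpectrum.mem_zeroLocus] at hp
  exact PrimeSpectrum.ext ((le_maximalIdeal p.2.ne_top).antisymm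
    (p.2.le_of_pow_le (h.trans hp)))

omit [IsLocalRing R] in
lemma Module.Finite.of_isFiniteLength {M : Type*} [AddCommGroup M] [Module R M]
    (h : IsFiniteLength R M) : Module.Finite R M :=
  have := (isFiniteLength_iff_isNoetherian_isArtinian.1 h).1
  inferInstance

lemma IsFiniteLength.nontrivial_linearMap {M : ModuleCat.{u} R} (h : IsFiniteLength R M)
    [hM : Nontrivial M] : Nontrivial (ResidueField R →ₗ[R] M) := by
  have := (isFiniteLength_iff_isNoetherian_isArtinian.1 h).2
  obtain ⟨N, hN⟩ := IsAtomic.exists_atom (Submodule R M)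
  have := isSimpleModule_iff_isAtom.2 hN
  obtain ⟨e⟩ := nonempty_equiv_residueField (R := R) N
  refine ⟨N.subtype ∘ₗ e.symm.toLinearMap, 0, fun h0 => ?_⟩
  have := LinearMap.congr_fun h0 1
  simp at this

lemma smul_residueField_eq_zero {r : R} (hr : r ∈ maximalIdeal R) (z : ResidueField R) :
    r • z = 0 := by
  rw [Algebra.smul_def,
    show algebraMap R (ResidueField R) r = 0 from (residue_eq_zero_iff r).2 hr, zero_mul]

lemma maximalIdeal_smul_top_lt_top (M : Type*) [AddCommGroup M] [Module R M] [Module.Finite R M]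
    [Nontrivial M] : maximalIdeal R • (⊤ : Submodule R M) < ⊤ :=
  lt_top_iff_ne_top.2
    (Submodule.top_ne_ideal_smul_of_le_jacobson_annihilator (maximalIdeal_le_jacobson _)).symm

lemma support_residueField : Module.support R (ResidueField R) =
    PrimeSpectrum.zeroLocus (maximalIdeal R) := by
  change Module.support R (R ⧸ maximalIdeal R) = _
  rw [Module.support_eq_zeroLocus, Ideal.annihilator_quotient]

variable [IsNoetherianRing R]

/-- A longer regular sequence in the maximal ideal would kill Ext^n(k, M); conversely the vanishing
below n produces a regular sequence of length n. -/
lemma moduleDepth_eq (M : Type u) [AddCommGroup M] [Module R M] [Module.Finite R M]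
    [Nontrivial M] {n : ℕ}
    (h : ∀ i < n, Subsingleton (Ext (ModuleCat.of R (ResidueField R)) (ModuleCat.of R M) i))
    (h' : Nontrivial (Ext (ModuleCat.of R (ResidueField R)) (ModuleCat.of R M) n)) :
    moduleDepth R M = n := by
  refine le_antisymm (iSup₂_le fun rs hrs => ?_) ?_
  · by_contra! hlt
    have := (hrs.2.toIsWeaklyRegular.ext_eq (ResidueField R) rs
      (fun r hr => smul_residueField_eq_zero (hrs.1 r hr)) M).1 n (by exact_mod_cast hlt)
    exact not_subsingleton _ this
  · obtain ⟨rs, rfl, hrs, hreg⟩ := ModuleCat.exists_isRegular_of_exists_subsingleton_ext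
      (maximalIdeal R) n (ModuleCat.of R M) (maximalIdeal_smul_top_lt_top M)
      (ModuleCat.of R (ResidueField R)) support_residueField h
    exact le_iSup₂_of_le rs ⟨hrs, hreg⟩ le_rfl

/-- The depth of a nonzero finitely generated module is the least `n` with `Ext^n(k, M) ≠ 0`, and
it is attained by a regular sequence. -/
lemma exists_isRegular_moduleDepth_eq (M : Type u) [AddCommGroup M] [Module R M] [Module.Finite R M]
    [Nontrivial M] : ∃ rs : List R, (∀ r ∈ rs, r ∈ maximalIdeal R) ∧ IsRegular M rs ∧
      moduleDepth R M = rs.length ∧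
      (∀ i < rs.length,
        Subsingleton (Ext (ModuleCat.of R (ResidueField R)) (ModuleCat.of R M) i)) ∧
      Nontrivial (Ext (ModuleCat.of R (ResidueField R)) (ModuleCat.of R M) rs.length) ∧
      Nonempty (Ext (ModuleCat.of R (ResidueField R)) (ModuleCat.of R M) rs.length ≃ₗ[R]
        (ResidueField R →ₗ[R] M ⧸ (Ideal.ofList rs • ⊤ : Submodule R M))) := by
  classical
  have hex : ∃ n, Nontrivial (Ext (ModuleCat.of R (ResidueField R)) (ModuleCat.of R M) n) := by
    -- If every Ext^n(k, M) vanished, there would be regular sequences of any length, but each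
    -- element of such a sequence lowers the dimension by one.
    by_contra hex
    have hall := fun n => not_nontrivial_iff_subsingleton.1 (not_exists.1 hex n)
    have hdim : Module.supportDim R M ≠ ⊤ := fun h => by
      have := Module.supportDim_le_ringKrullDim R M
      rw [h, top_le_iff] at this
      exact ringKrullDim_ne_top this
    obtain ⟨d, hd⟩ : ∃ d : ℕ, Module.supportDim R M < d := by
      generalize Module.supportDim R M = a at hdim
      induction a with
      | bot => exact ⟨0, WithBot.bot_lt_coe _⟩
      | coe a =>
        lift a to ℕ using fun h => hdim (by rw [h]; rfl)
        exact ⟨a + 1, by exact_mod_cast Nat.lt_succ_self a⟩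
    obtain ⟨rs, rfl, hrs, hreg⟩ := ModuleCat.exists_isRegular_of_exists_subsingleton_ext
      (maximalIdeal R) d (ModuleCat.of R M) (maximalIdeal_smul_top_lt_top M)
      (ModuleCat.of R (ResidueField R)) support_residueField fun i _ => hall i
    have := Module.supportDim_add_length_eq_supportDim_of_isRegular rs hreg
    have hnt := hreg.quot_ofList_smul_nontrivial ⊤
    rw [← this] at hd
    revert hd
    have hne := Module.supportDim_ne_bot_of_nontrivial R (M ⧸ (Ideal.ofList rs • ⊤ : Submodule R M))
    generalize Module.supportDim R (M ⧸ (Ideal.ofList rs • ⊤ : Submodule R M)) = a at hne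
    induction a with
    | bot => exact absurd rfl hne
    | coe a =>
      rw [imp_false, not_lt]
      exact_mod_cast (le_add_self : (rs.length : ℕ∞) ≤ a + rs.length)
  have hlt : ∀ i < Nat.find hex,
      Subsingleton (Ext (ModuleCat.of R (ResidueField R)) (ModuleCat.of R M) i) := fun i hi =>
    not_nontrivial_iff_subsingleton.1 (Nat.find_min hex hi)
  obtain ⟨rs, hlen, hrs, hreg⟩ := ModuleCat.exists_isRegular_of_exists_subsingleton_ext
    (maximalIdeal R) (Nat.find hex) (ModuleCat.of R M) (maximalIdeal_smul_top_lt_top M)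
    (ModuleCat.of R (ResidueField R)) support_residueField hlt
  have hnt := Nat.find_spec hex
  rw [← hlen] at hlt hnt
  exact ⟨rs, hrs, hreg, moduleDepth_eq M hlt hnt, hlt, hnt, (hreg.toIsWeaklyRegular.ext_eq
    (ResidueField R) rs (fun r hr => smul_residueField_eq_zero (hrs r hr)) M).2⟩

-- As R → k is surjective, lengths over R and k agree. Working with lengths over R removes the
-- auxiliary k-structure from all later arguments.
omit [IsNoetherianRing R] in
lemma moduleType_eq_one_iff (M : Type u) [AddCommGroup M] [Module R M] {n : ℕ}
    (h : moduleDepth R M = n) : moduleType R M = 1 ↔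
      Module.length R (Ext (ModuleCat.of R (ResidueField R)) (ModuleCat.of R M) n) = 1 := by
  have hn : (moduleDepth R M).toNat = n := by rw [h]; rfl
  subst hn
  let := extResidueFieldModule R M (moduleDepth R M).toNat
  have : IsScalarTower R (ResidueField R) (Ext (ModuleCat.of R (ResidueField R))
      (ModuleCat.of R M) (moduleDepth R M).toNat) :=
    (ext_residueField_isTorsionBySet R M (moduleDepth R M).toNat).isScalarTower
  rw [Module.length_eq_of_surjective (R := ResidueField R) (S := R) residue_surjective,
    Module.length_eq_rank]
  unfold moduleType Module.finrank
  rw [Cardinal.toENat_eq_one]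
  exact Cardinal.toNat_eq_one

end RegularSequences

/-! ### Ext into a dual: Ext^t(X, Hom(P, C)) against Hom(P, Ext^t(X, C)). -/

section ExtDual

variable {R : Type u} [CommRing R]

/-- If `Ext¹(D, C) = 0` then `Hom(-, C)` keeps `0 → A → B → D → 0` exact. -/
lemma Function.Exact.shortExact_lcomp {A B D C : Type u} [AddCommGroup A] [Module R A]
    [AddCommGroup B] [Module R B] [AddCommGroup D] [Module R D] [AddCommGroup C] [Module R C]
    {f : A →ₗ[R] B} {g : B →ₗ[R] D} (h : Function.Exact f g) (hf : Function.Injective f)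
    (hg : Function.Surjective g) (hD : Subsingleton (Ext (ModuleCat.of R D) (ModuleCat.of R C) 1)) :
    Function.Injective (g.lcomp R C) ∧ Function.Exact (g.lcomp R C) (f.lcomp R C) ∧
      Function.Surjective (f.lcomp R C) := by
  refine ⟨LinearMap.lcomp_injective_of_surjective g hg,
    LinearMap.exact_lcomp_of_exact_of_surjective C h hg, fun a => ?_⟩
  obtain ⟨b, hb⟩ := (h.shortExact hf hg).precomp_f_surjective (add_comm 1 0) hD
    (Ext.mk₀ (ModuleCat.ofHom a))
  obtain ⟨b, rfl⟩ := Ext.addEquiv₀.symm.surjective b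
  refine ⟨b.hom, ?_⟩
  have h1 : ModuleCat.ofHom f ≫ b = ModuleCat.ofHom a := by
    apply Ext.addEquiv₀.symm.injective
    simpa using hb
  exact congr(ModuleCat.Hom.hom $h1)

section Dual

variable (X : ModuleCat.{u} R) {P C : Type u} [AddCommGroup P] [Module R P]
  [AddCommGroup C] [Module R C]

/-- Evaluation at `p`, as a morphism `Hom(P, C) → C`. -/
noncomputable abbrev evalHom (C : Type u) [AddCommGroup C] [Module R C] (p : P) :
    ModuleCat.of R (P →ₗ[R] C) ⟶ ModuleCat.of R C :=
  ModuleCat.ofHom (LinearMap.applyₗ p)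

/-- The morphism `C → Hom(P, C)` attached to the `j`-th coordinate of a free module `P`. -/
noncomputable abbrev coordHom (C : Type u) [AddCommGroup C] [Module R C] [Module.Free R P]
    (j : Module.Free.ChooseBasisIndex R P) :
    ModuleCat.of R C ⟶ ModuleCat.of R (P →ₗ[R] C) :=
  ModuleCat.ofHom (LinearMap.smulRightₗ ((Module.Free.chooseBasis R P).coord j))

variable {X}

/-- For P free of finite rank, Hom(P, C) is a finite power of C, and its identity is the sum of the
coordinate idempotents. -/
lemma ext_dual_free_eq_sum [Module.Free R P] [Module.Finite R P] {n : ℕ}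
    (e : Ext X (ModuleCat.of R (P →ₗ[R] C)) n) :
    e = ∑ j, (e.comp (Ext.mk₀ (evalHom C (Module.Free.chooseBasis R P j))) (add_zero n)).comp
      (Ext.mk₀ (coordHom C j))
        (add_zero n) := by
  have h : 𝟙 (ModuleCat.of R (P →ₗ[R] C)) =
      ∑ j, evalHom C (Module.Free.chooseBasis R P j) ≫
        coordHom C j := by
    ext f x
    have hx : f x = ∑ j, (Module.Free.chooseBasis R P).repr x j •
        f (Module.Free.chooseBasis R P j) := by
      conv_lhs => rw [← (Module.Free.chooseBasis R P).sum_repr x, map_sum]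
      simp only [map_smul]
    simpa [ModuleCat.hom_sum, LinearMap.sum_apply] using hx
  conv_lhs => rw [← Ext.comp_mk₀_id e, h, Ext.mk₀_sum, Ext.comp_sum]
  simp

lemma ext_dual_free_eq_zero [Module.Free R P] [Module.Finite R P] {n : ℕ}
    (e : Ext X (ModuleCat.of R (P →ₗ[R] C)) n)
    (he : ∀ p, e.comp (Ext.mk₀ (evalHom C p)) (add_zero n) = 0) : e = 0 := by
  rw [ext_dual_free_eq_sum e]
  simp only [he, Ext.zero_comp, Finset.sum_const_zero]

lemma exists_ext_dual_free [Module.Free R P] [Module.Finite R P] {n : ℕ}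
    (φ : P →ₗ[R] Ext X (ModuleCat.of R C) n) :
    ∃ e : Ext X (ModuleCat.of R (P →ₗ[R] C)) n,
      ∀ p, e.comp (Ext.mk₀ (evalHom C p)) (add_zero n) = φ p := by
  refine ⟨∑ j, (φ (Module.Free.chooseBasis R P j)).comp
    (Ext.mk₀ (coordHom C j))
      (add_zero n), fun p => ?_⟩
  have h (j) : coordHom C j ≫ evalHom C p =
      (Module.Free.chooseBasis R P).coord j p • 𝟙 (ModuleCat.of R C) := by
    ext c
    simp
  rw [Ext.sum_comp]
  simp only [Ext.comp_assoc_of_third_deg_zero, Ext.mk₀_comp_mk₀, h, Ext.mk₀_smul, Ext.comp_smul,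
    Ext.comp_mk₀_id, ← map_smul, ← map_sum]
  congr 1
  exact (Module.Free.chooseBasis R P).sum_repr p

variable [IsNoetherianRing R] [Module.Finite R P]
  (hP : ∀ i, 0 < i → Subsingleton (Ext (ModuleCat.of R P) (ModuleCat.of R C) i))
  {t : ℕ} (hX : ∀ i < t, Subsingleton (Ext X (ModuleCat.of R C) i))

variable (R P) in
lemma exists_finite_free_presentation : ∃ (F K : Type u) (_ : AddCommGroup F) (_ : Module R F)
    (_ : AddCommGroup K) (_ : Module R K) (ι : K →ₗ[R] F) (π : F →ₗ[R] P),
    Module.Free R F ∧ Module.Finite R F ∧ Module.Finite R K ∧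
      Function.Injective ι ∧ Function.Surjective π ∧ Function.Exact ι π := by
  obtain ⟨F, _, _, _, _, π, hπ⟩ := Module.exists_finite_presentation R P
  exact ⟨F, LinearMap.ker π, _, _, _, _, (LinearMap.ker π).subtype, π, inferInstance,
    inferInstance, inferInstance, Submodule.injective_subtype _, hπ, LinearMap.exact_subtype_ker_map π⟩

omit [IsNoetherianRing R] [Module.Finite R P] in
include hP in
lemma subsingleton_ext_syzygy {F K : Type u} [AddCommGroup F] [Module R F] [AddCommGroup K]
    [Module R K] {ι : K →ₗ[R] F} {π : F →ₗ[R] P} [Module.Free R F] (hι : Function.Injective ι)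
    (hπ : Function.Surjective π) (h : Function.Exact ι π) (i : ℕ) (hi : 0 < i) :
    Subsingleton (Ext (ModuleCat.of R K) (ModuleCat.of R C) i) := by
  have : Projective (ModuleCat.of R F) := ModuleCat.projective_of_free (Module.Free.chooseBasis R F)
  obtain ⟨i, rfl⟩ : ∃ j, i = j + 1 := ⟨i - 1, by omega⟩
  exact (h.shortExact hι hπ).subsingleton_ext_X₁ rfl
    (Ext.subsingleton_of_projective (ModuleCat.of R F) _ i) (hP _ (by omega))

include hP hX

/-- `Hom(P, C)` has at least the depth of `C`, if `Ext^i(P, C) = 0` for `i > 0`. -/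
lemma subsingleton_ext_dual : ∀ i < t, Subsingleton (Ext X (ModuleCat.of R (P →ₗ[R] C)) i) := by
  intro i
  induction i generalizing P with
  | zero =>
    intro h0
    refine subsingleton_of_forall_eq 0 fun e => ?_
    obtain ⟨F, K, _, _, _, _, ι, π, _, _, _, hι, hπ, h⟩ := exists_finite_free_presentation R P
    obtain ⟨h1, h2, h3⟩ := h.shortExact_lcomp hι hπ (hP 1 one_pos)
    refine (h2.shortExact h1 h3).postcomp_f_injective_zero X ?_
    rw [map_zero]
    exact ext_dual_free_eq_zero _ fun p => (hX 0 h0).elim _ _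
  | succ i ih =>
    intro hi
    obtain ⟨F, K, _, _, _, _, ι, π, _, _, _, hι, hπ, h⟩ := exists_finite_free_presentation R P
    obtain ⟨h1, h2, h3⟩ := h.shortExact_lcomp hι hπ (hP 1 one_pos)
    -- The dual sequence 0 → Hom(P, C) → Hom(F, C) → Hom(K, C) → 0 shifts the degree, and the syzygy
    -- K satisfies the same vanishing as P.
    refine (h2.shortExact h1 h3).subsingleton_ext_to_X₁ rfl
      (ih (subsingleton_ext_syzygy hP hι hπ h) (by omega))
      (subsingleton_of_forall_eq 0 fun e => ext_dual_free_eq_zero e fun p => (hX _ hi).elim _ _)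

/-- Injectivity of Ext^t(X, Hom(P, C)) → Hom(P, Ext^t(X, C)). It is reduced to a free cover F of P:
Ext^t(X, Hom(P, C)) embeds in Ext^t(X, Hom(F, C)), as Hom(K, C) has no Ext from X in degree t - 1.
-/
lemma ext_dual_eq_zero (e : Ext X (ModuleCat.of R (P →ₗ[R] C)) t)
    (he : ∀ p, e.comp (Ext.mk₀ (evalHom C p)) (add_zero t) = 0) : e = 0 := by
  obtain ⟨F, K, _, _, _, _, ι, π, _, _, _, hι, hπ, h⟩ := exists_finite_free_presentation R P
  obtain ⟨h1, h2, h3⟩ := h.shortExact_lcomp hι hπ (hP 1 one_pos)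
  have hS := h2.shortExact h1 h3
  have hinj : Function.Injective
      ((Ext.mk₀ (ModuleCat.ofHom (π.lcomp R C))).postcompOfLinear R X (add_zero t)) := by
    cases t with
    | zero => exact hS.postcomp_f_injective_zero X
    | succ t =>
      exact hS.postcomp_f_injective rfl
        (subsingleton_ext_dual (subsingleton_ext_syzygy hP hι hπ h) hX t (by omega))
  refine hinj ?_
  rw [map_zero]
  refine ext_dual_free_eq_zero _ fun p => ?_
  change (e.comp (Ext.mk₀ (ModuleCat.ofHom (π.lcomp R C))) (add_zero t)).comp _ _ = 0
  rw [Ext.comp_assoc_of_third_deg_zero e, Ext.mk₀_comp_mk₀]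
  exact he (π p)

/-- Surjectivity of the same map: a class realizing φ ∘ π for the free cover restricts to zero on
the syzygy K, by the injectivity there, and so lifts to Hom(P, C). -/
lemma exists_ext_dual (φ : P →ₗ[R] Ext X (ModuleCat.of R C) t) :
    ∃ e : Ext X (ModuleCat.of R (P →ₗ[R] C)) t,
      ∀ p, e.comp (Ext.mk₀ (evalHom C p)) (add_zero t) = φ p := by
  obtain ⟨F, K, _, _, _, _, ι, π, _, _, _, hι, hπ, h⟩ := exists_finite_free_presentation R P
  obtain ⟨h1, h2, h3⟩ := h.shortExact_lcomp hι hπ (hP 1 one_pos)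
  have hS := h2.shortExact h1 h3
  obtain ⟨eF, heF⟩ := exists_ext_dual_free (φ ∘ₗ π)
  obtain ⟨e, he⟩ := Ext.covariant_sequence_exact₂ X hS eF
    (ext_dual_eq_zero (subsingleton_ext_syzygy hP hι hπ h) hX _ fun k => by
      rw [Ext.comp_assoc_of_third_deg_zero, Ext.mk₀_comp_mk₀]
      refine (heF (ι k)).trans ?_
      rw [LinearMap.comp_apply, h.apply_apply_eq_zero, map_zero])
  refine ⟨e, fun p => ?_⟩
  obtain ⟨x, rfl⟩ := hπ p
  refine Eq.trans ?_ (heF x)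
  rw [← he, Ext.comp_assoc_of_third_deg_zero, Ext.mk₀_comp_mk₀]
  rfl

end Dual

end ExtDual

/-! ### Totally reflexive modules, reflexive resolutions and the Yoneda pairing. -/

section TotallyReflexive

variable {R : Type u} [CommRing R] {C : Type u} [AddCommGroup C] [Module R C]

namespace IsTotallyReflexive

lemma of_subsingleton (M : Type u) [AddCommGroup M] [Module R M] [Subsingleton M] :
    IsTotallyReflexive R C M where
  finite := inferInstance
  evaluation_bijective := by
    have : Subsingleton ((M →ₗ[R] C) →ₗ[R] C) :=
      subsingleton_of_forall_eq 0 fun f => LinearMap.ext fun g => by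
        rw [Subsingleton.elim g 0, map_zero, map_zero]
    exact ⟨Function.injective_of_subsingleton _, fun y => ⟨0, Subsingleton.elim _ _⟩⟩
  ext_eq_zero i _ := Ext.subsingleton_of_subsingleton_left _ _ i
  ext_hom_eq_zero i _ :=
    have : Subsingleton (ModuleCat.of R (M →ₗ[R] C)) :=
      inferInstanceAs (Subsingleton (M →ₗ[R] C))
    Ext.subsingleton_of_subsingleton_left _ _ i

lemma congr {M N : Type u} [AddCommGroup M] [Module R M] [AddCommGroup N] [Module R N]
    (e : M ≃ₗ[R] N) (h : IsTotallyReflexive R C M) : IsTotallyReflexive R C N where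
  finite := have := h.finite; Module.Finite.equiv e
  evaluation_bijective := by
    let e' : (M →ₗ[R] C) ≃ₗ[R] (N →ₗ[R] C) := e.arrowCongr (.refl R C)
    let e'' : ((M →ₗ[R] C) →ₗ[R] C) ≃ₗ[R] ((N →ₗ[R] C) →ₗ[R] C) := e'.arrowCongr (.refl R C)
    have h1 : (LinearMap.applyₗ : N →ₗ[R] (N →ₗ[R] C) →ₗ[R] C) =
        e''.toLinearMap ∘ₗ (LinearMap.applyₗ : M →ₗ[R] (M →ₗ[R] C) →ₗ[R] C) ∘ₗ e.symm.toLinearMap := by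
      ext x f
      simp [e'', e']
    rw [h1]
    exact e''.bijective.comp (h.evaluation_bijective.comp e.symm.bijective)
  ext_eq_zero i hi := have := h.ext_eq_zero i hi; (Ext.congrLeft e _ i).subsingleton
  ext_hom_eq_zero i hi :=
    have := h.ext_hom_eq_zero i hi
    let e' : (M →ₗ[R] C) ≃ₗ[R] (N →ₗ[R] C) := e.arrowCongr (.refl R C)
    (Ext.congrLeft e' _ i).subsingleton

section

variable [IsNoetherianRing R] [Module.Finite R C] {X : ModuleCat.{u} R} {t : ℕ}
  (hX : ∀ i < t, Subsingleton (Ext X (ModuleCat.of R C) i)) {G : Type u} [AddCommGroup G]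
  [Module R G] (h : IsTotallyReflexive R C G)

/-- The biduality isomorphism of a totally reflexive module. -/
noncomputable def evaluationEquiv {G : Type u} [AddCommGroup G]
    [Module R G] (h : IsTotallyReflexive R C G) : G ≃ₗ[R] ((G →ₗ[R] C) →ₗ[R] C) :=
  LinearEquiv.ofBijective _ h.evaluation_bijective

include hX h

lemma subsingleton_ext (i : ℕ) (hi : i < t) : Subsingleton (Ext X (ModuleCat.of R G) i) := by
  have := h.finite
  have := subsingleton_ext_dual h.ext_hom_eq_zero hX i hi
  exact (Ext.congrRight X h.evaluationEquiv i).subsingleton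

/-- Biduality writes G as Hom(P, C) with P = Hom(G, C), so the results on duals apply. With
`exists_ext_comp_eq` this is the length-zero case of the pairing. -/
lemma ext_eq_zero_of_forall_comp (e : Ext X (ModuleCat.of R G) t)
    (he : ∀ f : G →ₗ[R] C, e.comp (Ext.mk₀ (ModuleCat.ofHom f)) (add_zero t) = 0) : e = 0 := by
  have := h.finite
  apply (Ext.congrRight X h.evaluationEquiv t).injective
  rw [map_zero]
  refine ext_dual_eq_zero h.ext_hom_eq_zero hX _ fun f => ?_
  change (e.comp (Ext.mk₀ _) (add_zero t)).comp _ (add_zero t) = 0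
  rw [Ext.comp_assoc_of_third_deg_zero, Ext.mk₀_comp_mk₀]
  exact he f

lemma exists_ext_comp_eq (φ : (G →ₗ[R] C) →ₗ[R] Ext X (ModuleCat.of R C) t) :
    ∃ e : Ext X (ModuleCat.of R G) t,
      ∀ f : G →ₗ[R] C, e.comp (Ext.mk₀ (ModuleCat.ofHom f)) (add_zero t) = φ f := by
  have := h.finite
  obtain ⟨e, he⟩ := exists_ext_dual h.ext_hom_eq_zero hX φ
  obtain ⟨e, rfl⟩ := (Ext.congrRight X h.evaluationEquiv t).surjective e
  refine ⟨e, fun f => ?_⟩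
  rw [← he]
  change _ = (e.comp (Ext.mk₀ _) (add_zero t)).comp _ (add_zero t)
  rw [Ext.comp_assoc_of_third_deg_zero, Ext.mk₀_comp_mk₀]
  rfl

end

/-- The cokernel `M` of an injective map of totally reflexive modules is totally reflexive if
`Ext¹(M, C) = 0`. -/
lemma of_shortExact {K G M : Type u} [AddCommGroup K] [Module R K] [AddCommGroup G] [Module R G]
    [AddCommGroup M] [Module R M] {f : K →ₗ[R] G} {g : G →ₗ[R] M} (hf : Function.Injective f)
    (hg : Function.Surjective g) (hfg : Function.Exact f g) (hK : IsTotallyReflexive R C K)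
    (hG : IsTotallyReflexive R C G)
    (h : Subsingleton (Ext (ModuleCat.of R M) (ModuleCat.of R C) 1)) :
    IsTotallyReflexive R C M := by
  have := hG.finite
  obtain ⟨h1, h2, h3⟩ := hfg.shortExact_lcomp hf hg h
  have hS := h2.shortExact h1 h3
  have h4 := (h2.shortExact_lcomp h1 h3 (hK.ext_hom_eq_zero 1 one_pos)).2.2
  refine ⟨Module.Finite.of_surjective g hg, ⟨?_, fun θ => ?_⟩, fun i hi => ?_, fun i hi => ?_⟩
  · rw [injective_iff_map_eq_zero]
    intro m hm
    obtain ⟨x, rfl⟩ := hg m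
    -- Evaluation at x vanishes on Hom(M, C), so it factors through Hom(K, C); biduality of K and G
    -- then shows that x comes from K.
    have hx : (LinearMap.applyₗ x : (G →ₗ[R] C) →ₗ[R] C) ∘ₗ g.lcomp R C = 0 := hm
    obtain ⟨κ, hκ⟩ := (LinearMap.exact_lcomp_of_exact_of_surjective C h2 h3 (LinearMap.applyₗ x)).1 hx
    obtain ⟨k, rfl⟩ := hK.evaluation_bijective.2 κ
    have : x = f k := hG.evaluation_bijective.1 hκ.symm
    rw [this, hfg.apply_apply_eq_zero]
  · obtain ⟨θ', hθ'⟩ := h4 θ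
    obtain ⟨x, rfl⟩ := hG.evaluation_bijective.2 θ'
    exact ⟨g x, hθ'⟩
  · obtain rfl | ⟨i, rfl⟩ : i = 1 ∨ ∃ j, i = 1 + (j + 1) := by
      rcases i with _ | _ | i
      · omega
      · exact .inl rfl
      · exact .inr ⟨i, by omega⟩
    · exact h
    · exact (hfg.shortExact hf hg).subsingleton_ext_X₃ rfl (hK.ext_eq_zero _ (by omega))
        (hG.ext_eq_zero _ (by omega))
  · exact hS.subsingleton_ext_X₁ rfl (hG.ext_hom_eq_zero _ hi) (hK.ext_hom_eq_zero _ (by omega))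

end IsTotallyReflexive

variable (R C) in
/-- `M` has a resolution of length `n` by totally `C`-reflexive modules, as a sequence of short
exact sequences. -/
def HasReflexiveResolution : ℕ → ∀ (M : Type u) [AddCommGroup M] [Module R M], Prop
  | 0, M, _, _ => IsTotallyReflexive R C M
  | n + 1, M, _, _ => ∃ (K G : ModuleCat.{u} R) (f : K →ₗ[R] G) (g : G →ₗ[R] M),
      Function.Injective f ∧ Function.Surjective g ∧ Function.Exact f g ∧
        IsTotallyReflexive R C G ∧ HasReflexiveResolution n K

lemma HasGCDimLE.hasReflexiveResolution {n : ℕ} {M : Type u} [AddCommGroup M] [Module R M]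
    (h : HasGCDimLE R C M n) : HasReflexiveResolution R C n M := by
  induction n generalizing M with
  | zero =>
    obtain ⟨G, d, ε, hG, hG', hε, hd, -⟩ := h
    have := hG' 1 one_pos
    refine IsTotallyReflexive.congr (LinearEquiv.ofBijective ε ⟨?_, hε⟩) (hG 0 le_rfl)
    rw [injective_iff_map_eq_zero]
    intro x hx
    obtain ⟨y, rfl⟩ := (hd x).1 hx
    rw [Subsingleton.elim y 0, map_zero]
  | succ n ih =>
    obtain ⟨G, d, ε, hG, hG', hε, hd, hd'⟩ := h
    refine ⟨ModuleCat.of R (LinearMap.ker ε), G 0, (LinearMap.ker ε).subtype, ε,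
      Submodule.injective_subtype _, hε, LinearMap.exact_subtype_ker_map ε, hG 0 (by omega), ih ?_⟩
    refine ⟨fun i => G (i + 1), fun i => d (i + 1),
      (d 0).codRestrict (LinearMap.ker ε) fun x => hd.apply_apply_eq_zero x,
      fun i hi => hG _ (by omega), fun i hi => hG' _ (by omega), ?_, ?_, fun i => hd' _⟩
    · rintro ⟨x, hx⟩
      obtain ⟨y, rfl⟩ := (hd x).1 hx
      exact ⟨y, rfl⟩
    · intro x
      rw [← hd' 0 x, Subtype.ext_iff]
      rfl

namespace HasReflexiveResolution

lemma succ {n : ℕ} {M : Type u} [AddCommGroup M] [Module R M]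
    (h : HasReflexiveResolution R C n M) : HasReflexiveResolution R C (n + 1) M := by
  induction n generalizing M with
  | zero =>
    refine ⟨ModuleCat.of R PUnit, ModuleCat.of R M, 0, LinearMap.id,
      Function.injective_of_subsingleton _, Function.surjective_id, fun x => ?_, h,
      IsTotallyReflexive.of_subsingleton PUnit⟩
    exact ⟨fun hx => ⟨0, hx.symm⟩, fun ⟨y, hy⟩ => hy.symm⟩
  | succ n ih =>
    obtain ⟨K, G, f, g, hf, hg, hfg, hG, hK⟩ := h
    exact ⟨K, G, f, g, hf, hg, hfg, hG, ih hK⟩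

lemma mono {n m : ℕ} (hnm : n ≤ m) {M : Type u} [AddCommGroup M] [Module R M]
    (h : HasReflexiveResolution R C n M) : HasReflexiveResolution R C m M := by
  induction m, hnm using Nat.le_induction with
  | base => exact h
  | succ m _ ih => exact ih.succ

lemma subsingleton_ext {n : ℕ} {M : Type u} [AddCommGroup M] [Module R M]
    (h : HasReflexiveResolution R C n M) (i : ℕ) (hi : n < i) :
    Subsingleton (Ext (ModuleCat.of R M) (ModuleCat.of R C) i) := by
  induction n generalizing M i with
  | zero => exact h.ext_eq_zero i hi
  | succ n ih =>
    obtain ⟨K, G, f, g, hf, hg, hfg, hG, hK⟩ := h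
    obtain ⟨i, rfl⟩ : ∃ j, i = 1 + j := ⟨i - 1, by omega⟩
    exact (hfg.shortExact hf hg).subsingleton_ext_X₃ rfl (ih hK i (by omega))
      (hG.ext_eq_zero _ (by omega))

/-- Dimension shifting moves the hypothesis to Ext¹ of the last but one syzygy, the cokernel of a
map of totally reflexive modules; it is then totally reflexive, and the resolution stops there. -/
lemma of_subsingleton_ext {n : ℕ} {M : Type u} [AddCommGroup M] [Module R M]
    (h : HasReflexiveResolution R C (n + 1) M)
    (h' : Subsingleton (Ext (ModuleCat.of R M) (ModuleCat.of R C) (n + 1))) :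
    HasReflexiveResolution R C n M := by
  induction n generalizing M with
  | zero =>
    obtain ⟨K, G, f, g, hf, hg, hfg, hG, hK⟩ := h
    exact IsTotallyReflexive.of_shortExact hf hg hfg hK hG h'
  | succ n ih =>
    obtain ⟨K, G, f, g, hf, hg, hfg, hG, hK⟩ := h
    exact ⟨K, G, f, g, hf, hg, hfg, hG, ih hK <| (hfg.shortExact hf hg).subsingleton_ext_X₁
      (add_comm 1 (n + 1)) (hG.ext_eq_zero _ (by omega)) h'⟩

section Pairing

variable [IsNoetherianRing R] [Module.Finite R C] {X : ModuleCat.{u} R} {t : ℕ}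
  (hX : ∀ i < t, Subsingleton (Ext X (ModuleCat.of R C) i))

include hX

/-- The Yoneda pairing `Ext^{t-n}(X, M) → Hom(Ext^n(M, C), Ext^t(X, C))` is bijective, if `M` has a
reflexive resolution of length `n ≤ t` and `Ext^i(X, C) = 0` for `i < t`. -/
lemma pairing_bijective {n a : ℕ} (hn : a + n = t) {M : Type u} [AddCommGroup M] [Module R M]
    (h : HasReflexiveResolution R C n M) :
    Function.Bijective (Ext.bilinearCompOfLinear R X (ModuleCat.of R M) (ModuleCat.of R C)
      a n t hn) := by
  induction n generalizing a M with
  | zero =>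
    obtain rfl : a = t := hn
    change IsTotallyReflexive R C M at h
    constructor
    · rw [injective_iff_map_eq_zero]
      intro e he
      exact h.ext_eq_zero_of_forall_comp hX e fun f =>
        LinearMap.congr_fun he (Ext.mk₀ (ModuleCat.ofHom f))
    · intro φ
      obtain ⟨e, he⟩ := h.exists_ext_comp_eq hX (φ ∘ₗ (Ext.zeroEquivLinearMap M C).symm.toLinearMap)
      refine ⟨e, LinearMap.ext fun f => ?_⟩
      obtain ⟨f, rfl⟩ := (Ext.zeroEquivLinearMap M C).symm.surjective f
      exact he f
  | succ n ih =>
    obtain ⟨K, G, f, g, hf, hg, hfg, hG, hK⟩ := h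
    have hS := hfg.shortExact hf hg
    have ih := ih (show (a + 1) + n = t by omega) hK
    constructor
    · rw [injective_iff_map_eq_zero]
      intro e he
      -- The product with the class of 0 → K → G → M → 0 pairs to zero with Ext^n(K, C), so it
      -- vanishes by induction. Then e lifts to Ext^a(X, G), which is zero because a < t.
      have h1 : e.comp hS.extClass rfl = 0 := by
        apply ih.1
        rw [map_zero]
        refine LinearMap.ext fun f' => ?_
        have := LinearMap.congr_fun he (hS.extClass.comp f' (add_comm 1 n))
        refine Eq.trans ?_ this
        exact Ext.comp_assoc _ _ _ _ _ (by omega)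
      obtain ⟨e', rfl⟩ := Ext.covariant_sequence_exact₃ X hS e rfl h1
      have := hG.subsingleton_ext hX a (by omega)
      have : e' = 0 := this.elim _ _
      rw [this, Ext.zero_comp]
    · intro φ
      obtain ⟨e', he'⟩ := ih.2 (φ ∘ₗ hS.extClass.precompOfLinear R (ModuleCat.of R C)
        (add_comm 1 n))
      -- The class representing φ on K must die in Ext^{a+1}(X, G) to come from M. This is automatic
      -- for a + 1 < t. For a + 1 = t it is tested on maps q : G → C, whose restrictions to K are
      -- killed by the connecting map.
      have h1 : e'.comp (Ext.mk₀ (ModuleCat.ofHom f)) (add_zero (a + 1)) = 0 := by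
        rcases Nat.eq_zero_or_pos n with rfl | hpos
        · obtain rfl : a + 1 = t := hn
          refine hG.ext_eq_zero_of_forall_comp hX _ fun q => ?_
          rw [Ext.comp_assoc_of_third_deg_zero]
          refine (LinearMap.congr_fun he' _).trans ?_
          change φ (hS.extClass.comp ((Ext.mk₀ (ModuleCat.ofHom f)).comp _ (zero_add 0)) (add_comm 1 0)) = 0
          rw [hS.extClass_comp_assoc, map_zero]
        · exact (hG.subsingleton_ext hX (a + 1) (by omega)).elim _ _
      obtain ⟨e, he⟩ := Ext.covariant_sequence_exact₁ X hS e' h1 rfl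
      refine ⟨e, LinearMap.ext fun z => ?_⟩
      obtain ⟨f', rfl⟩ := Ext.contravariant_sequence_exact₃ hS (ModuleCat.of R C) z
        ((hG.ext_eq_zero (n + 1) (by omega)).elim _ _) (add_comm 1 n)
      refine Eq.trans ?_ (LinearMap.congr_fun he' f')
      rw [← he]
      exact (Ext.comp_assoc _ _ _ _ _ (by omega)).symm

/-- The pairing one step beyond its range, where M would contribute Ext^{-1}(X, M) = 0: the class
representing φ lies in Hom(X, K) and dies in Hom(X, G), so it is zero. This drives the
Auslander–Buchsbaum bound. -/
lemma linearMap_ext_eq_zero {M : Type u} [AddCommGroup M] [Module R M]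
    (h : HasReflexiveResolution R C (t + 1) M)
    (φ : Ext (ModuleCat.of R M) (ModuleCat.of R C) (t + 1) →ₗ[R] Ext X (ModuleCat.of R C) t) :
    φ = 0 := by
  obtain ⟨K, G, f, g, hf, hg, hfg, hG, hK⟩ := h
  have hS := hfg.shortExact hf hg
  obtain ⟨e', he'⟩ := (hK.pairing_bijective hX (zero_add t)).2
    (φ ∘ₗ hS.extClass.precompOfLinear R (ModuleCat.of R C) (add_comm 1 t))
  have h1 : e'.comp (Ext.mk₀ (ModuleCat.ofHom f)) (add_zero 0) = 0 := by
    rcases Nat.eq_zero_or_pos t with rfl | hpos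
    · refine hG.ext_eq_zero_of_forall_comp hX _ fun q => ?_
      rw [Ext.comp_assoc_of_third_deg_zero]
      refine (LinearMap.congr_fun he' _).trans ?_
      change φ (hS.extClass.comp ((Ext.mk₀ (ModuleCat.ofHom f)).comp _ (zero_add 0)) (add_comm 1 0)) = 0
      rw [hS.extClass_comp_assoc, map_zero]
    · exact (hG.subsingleton_ext hX 0 hpos).elim _ _
  have h2 : e' = 0 := by
    apply hS.postcomp_f_injective_zero X
    rw [map_zero]
    exact h1
  refine LinearMap.ext fun z => ?_
  obtain ⟨f', rfl⟩ := Ext.contravariant_sequence_exact₃ hS (ModuleCat.of R C) z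
    ((hG.ext_eq_zero (t + 1) (by omega)).elim _ _) (add_comm 1 t)
  refine (LinearMap.congr_fun he' f').symm.trans ?_
  rw [h2, map_zero]
  rfl

end Pairing

end HasReflexiveResolution

end TotallyReflexive

/-! ### Consequences of the pairing for modules of finite length. -/

section FiniteLengthDuality

open IsLocalRing

variable {R : Type u} [CommRing R]

/-- `Hom(R / J, V) ≅ V` if `J` kills `V`. -/
lemma nonempty_quotient_linearMap_equiv {V : Type*} [AddCommGroup V] [Module R V] {J : Ideal R}
    (h : J ≤ Module.annihilator R V) : Nonempty (((R ⧸ J) →ₗ[R] V) ≃ₗ[R] V) := by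
  refine ⟨LinearEquiv.ofBijective (LinearMap.applyₗ (Ideal.Quotient.mk J 1)) ⟨?_, fun v => ?_⟩⟩
  · intro f g hfg
    refine Submodule.linearMap_qext _ (LinearMap.ext_ring ?_)
    exact hfg
  · refine ⟨J.liftQ (LinearMap.toSpanSingleton R V v) fun r hr => ?_, ?_⟩
    · rw [LinearMap.mem_ker, LinearMap.toSpanSingleton_apply]
      exact Module.mem_annihilator.1 (h hr) v
    · change LinearMap.toSpanSingleton R V v 1 = v
      rw [LinearMap.toSpanSingleton_apply, one_smul]

variable [IsLocalRing R]

lemma exists_submodule_quotient_equiv_residueField (E : Type*) [AddCommGroup E] [Module R E]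
    [Module.Finite R E] [Nontrivial E] :
    ∃ N : Submodule R E, Nonempty ((E ⧸ N) ≃ₗ[R] ResidueField R) := by
  obtain ⟨N, hN⟩ := IsCoatomic.exists_coatom (Submodule R E)
  have := isSimpleModule_iff_isCoatom.2 hN
  exact ⟨N, nonempty_equiv_residueField (E ⧸ N)⟩

lemma maximalIdeal_le_annihilator_ext (Y : ModuleCat.{u} R) (n : ℕ) :
    maximalIdeal R ≤
      Module.annihilator R (Ext (ModuleCat.of R (ResidueField R)) Y n) := fun _ hr =>
  Module.mem_annihilator.2 (Ext.smul_eq_zero_of_smul_left_eq_zero (smul_residueField_eq_zero hr))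

variable [IsNoetherianRing R]

lemma isFiniteLength_ext_residueField (Y : ModuleCat.{u} R) [Module.Finite R Y] (n : ℕ) :
    IsFiniteLength R (Ext (ModuleCat.of R (ResidueField R)) Y n) :=
  isFiniteLength_of_pow_le_annihilator _ 1
    (by rw [pow_one]; exact maximalIdeal_le_annihilator_ext Y n)

lemma isFiniteLength_quotient_of_pow_le {J : Ideal R} {n : ℕ} (h : maximalIdeal R ^ n ≤ J) :
    IsFiniteLength R (R ⧸ J) :=
  isFiniteLength_of_pow_le_annihilator _ n (by rwa [Ideal.annihilator_quotient])

lemma IsFiniteLength.ext {X Y : ModuleCat.{u} R} (hX : IsFiniteLength R X) [Module.Finite R Y]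
    (n : ℕ) : IsFiniteLength R (Ext X Y n) := by
  rw [← Module.length_ne_top_iff]
  refine ne_top_of_le_ne_top (WithTop.mul_ne_top (Module.length_ne_top_iff.2 hX)
    (Module.length_ne_top_iff.2 (isFiniteLength_ext_residueField Y n))) (hX.length_ext_le n)

section

variable {Y : ModuleCat.{u} R} {t : ℕ}
  (hY : ∀ i < t, Subsingleton (Ext (ModuleCat.of R (ResidueField R)) Y i))

include hY

omit [IsNoetherianRing R] in
/-- An element of `Ext^t(N, Y)` is determined by its restrictions along the maps `R / J → N`. -/
lemma ext_eq_zero_of_forall_quotient {J : Ideal R} (hJ : IsFiniteLength R (R ⧸ J))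
    {N : ModuleCat.{u} R} (hN : IsFiniteLength R N) (hJN : J ≤ Module.annihilator R N)
    (w : Ext N Y t)
    (hw : ∀ f : ModuleCat.of R (R ⧸ J) ⟶ N, (Ext.mk₀ f).comp w (zero_add t) = 0) : w = 0 := by
  revert hJN w
  refine IsFiniteLength.induction_residueField
    (P := fun N => J ≤ Module.annihilator R N → ∀ w : Ext N Y t,
      (∀ f : ModuleCat.of R (R ⧸ J) ⟶ N, (Ext.mk₀ f).comp w (zero_add t) = 0) → w = 0)
    (fun N hN _ w _ => ?_) (fun M N e hN ih hJM w hw => ?_) hN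
  · exact (Ext.subsingleton_of_subsingleton_left N Y t).elim _ _
  · have h0 := ih (hJM.trans (LinearMap.annihilator_le_of_injective _ N.injective_subtype))
      ((Ext.mk₀ (ModuleCat.ofHom N.subtype)).comp w (zero_add t)) fun f => by
        rw [Ext.mk₀_comp_mk₀_assoc]
        exact hw _
    obtain ⟨w', rfl⟩ := Ext.contravariant_sequence_exact₂ N.shortExact Y w h0
    have hsimple : IsSimpleModule R (M ⧸ N) := IsSimpleModule.congr e
    have := IsSimpleModule.nontrivial R (M ⧸ N)
    obtain ⟨y, hy⟩ := exists_ne (0 : M ⧸ N)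
    obtain ⟨x, rfl⟩ := N.mkQ_surjective y
    -- The map 1 ↦ x with x outside N is onto the simple module M/N. Its kernel has finite length,
    -- so pulling back along it is injective in degree t and w' must vanish.
    have hf : ∃ f : (R ⧸ J) →ₗ[R] M, f (Ideal.Quotient.mk J 1) = x := by
      refine ⟨J.liftQ (LinearMap.toSpanSingleton R M x) fun r hr => ?_, ?_⟩
      · rw [LinearMap.mem_ker, LinearMap.toSpanSingleton_apply]
        exact Module.mem_annihilator.1 (hJM hr) x
      · change LinearMap.toSpanSingleton R M x 1 = x
        rw [LinearMap.toSpanSingleton_apply, one_smul]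
    obtain ⟨f, rfl⟩ := hf
    have hsurj : Function.Surjective (N.mkQ ∘ₗ f) :=
      LinearMap.surjective_of_ne_zero fun h => hy (LinearMap.congr_fun h _)
    have hS := (LinearMap.exact_subtype_ker_map (N.mkQ ∘ₗ f)).shortExact
      (Submodule.injective_subtype _) hsurj
    have := hS.precomp_g_injective_of_lt
      (hJ.of_injective (Submodule.injective_subtype (LinearMap.ker (N.mkQ ∘ₗ f)))) hY
      (a₁ := w') (a₂ := 0) (by
        rw [map_zero]
        have := hw (ModuleCat.ofHom f)
        rw [Ext.mk₀_comp_mk₀_assoc] at this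
        exact this)
    rw [this, Ext.comp_zero]

omit [IsNoetherianRing R] in
/-- The socle of `Ext^t(R / J, Y)` comes from `Ext^t(k, Y)`. -/
lemma length_linearMap_ext_quotient_le {J : Ideal R} (hJ : IsFiniteLength R (R ⧸ J))
    (hJm : J ≤ maximalIdeal R) :
    Module.length R (ResidueField R →ₗ[R] Ext (ModuleCat.of R (R ⧸ J)) Y t) ≤
      Module.length R (Ext (ModuleCat.of R (ResidueField R)) Y t) := by
  let q : (R ⧸ J) →ₗ[R] ResidueField R := Submodule.mapQ J (maximalIdeal R) LinearMap.id hJm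
  have hq : Function.Surjective q := fun y => by
    obtain ⟨y, rfl⟩ := residue_surjective y
    exact ⟨Ideal.Quotient.mk J y, rfl⟩
  have hS := (LinearMap.exact_subtype_ker_map q).shortExact (Submodule.injective_subtype _) hq
  let qY := (Ext.mk₀ (ModuleCat.ofHom q)).precompOfLinear R Y (zero_add t)
  have key (w : Ext (ModuleCat.of R (R ⧸ J)) Y t) (hw : ∀ r ∈ maximalIdeal R, r • w = 0) :
      w ∈ LinearMap.range qY := by
    refine Ext.contravariant_sequence_exact₂ hS Y w ?_
    refine ext_eq_zero_of_forall_quotient hY hJ (hJ.of_injective (Submodule.injective_subtype _))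
      ?_ _ fun f => ?_
    · refine le_trans ?_ (LinearMap.annihilator_le_of_injective (LinearMap.ker q).subtype
        (Submodule.injective_subtype _))
      rw [Ideal.annihilator_quotient]
    -- A map from R/J into the image of m in R/J is multiplication by some a in m, and hence kills a
    -- socle element w.
    · obtain ⟨a, ha⟩ := Ideal.Quotient.mk_surjective (f.hom (Ideal.Quotient.mk J 1)).1
      have ham : a ∈ maximalIdeal R := by
        have : q (f.hom (Ideal.Quotient.mk J 1)).1 = 0 := (f.hom (Ideal.Quotient.mk J 1)).2
        rw [← ha] at this
        exact Ideal.Quotient.eq_zero_iff_mem.1 this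
      have hfa : f ≫ ModuleCat.ofHom (LinearMap.ker q).subtype = a • 𝟙 _ := by
        apply ModuleCat.hom_ext
        refine Submodule.linearMap_qext _ (LinearMap.ext_ring ?_)
        change (f.hom (Ideal.Quotient.mk J 1)).1 = a • Ideal.Quotient.mk J 1
        rw [← ha, Algebra.smul_def, map_one, mul_one]
        rfl
      rw [Ext.mk₀_comp_mk₀_assoc, hfa, Ext.mk₀_smul, Ext.smul_comp, Ext.mk₀_id_comp]
      exact hw a ham
  let ev : (ResidueField R →ₗ[R] Ext (ModuleCat.of R (R ⧸ J)) Y t) →ₗ[R] LinearMap.range qY :=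
    (LinearMap.applyₗ (1 : ResidueField R)).codRestrict _ fun f => key _ fun r hr => by
      change r • f 1 = 0
      rw [← map_smul, smul_residueField_eq_zero hr, map_zero]
  have hev : Function.Injective ev := fun f g hfg => by
    refine Submodule.linearMap_qext _ (LinearMap.ext_ring ?_)
    exact congrArg Subtype.val hfg
  exact (Module.length_le_of_injective ev hev).trans
    (Module.length_le_of_surjective qY.rangeRestrict qY.surjective_rangeRestrict)

end

variable {C : Type u} [AddCommGroup C] [Module R C] [Module.Finite R C] {t : ℕ}
  (hC : ∀ i < t, Subsingleton (Ext (ModuleCat.of R (ResidueField R)) (ModuleCat.of R C) i))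

omit [IsLocalRing R] [IsNoetherianRing R] [Module.Finite R C] in
lemma HasReflexiveResolution.finite {n : ℕ} {M : Type u} [AddCommGroup M] [Module R M]
    (h : HasReflexiveResolution R C n M) : Module.Finite R M := by
  cases n with
  | zero => exact IsTotallyReflexive.finite h
  | succ n =>
    obtain ⟨K, G, f, g, hf, hg, hfg, hG, hK⟩ := h
    have := hG.finite
    exact Module.Finite.of_surjective g hg

include hC

/-- Auslander–Buchsbaum bound: a module of finite `G_C`-dimension has `G_C`-dimension at most the
depth of `C`. -/
lemma HasReflexiveResolution.of_depth
    (hC' : Nontrivial (Ext (ModuleCat.of R (ResidueField R)) (ModuleCat.of R C) t))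
    {n : ℕ} {M : Type u} [AddCommGroup M] [Module R M] (h : HasReflexiveResolution R C n M) :
    HasReflexiveResolution R C t M := by
  rcases le_total n t with hn | hn
  · exact h.mono hn
  induction n, hn using Nat.le_induction generalizing M with
  | base => exact h
  | succ n hn ih =>
    obtain ⟨K, G, f, g, hf, hg, hfg, hG, hK⟩ := h
    have h : HasReflexiveResolution R C (t + 1) M := ⟨K, G, f, g, hf, hg, hfg, hG, ih hK⟩
    refine h.of_subsingleton_ext ?_
    by_contra hE
    rw [not_subsingleton_iff_nontrivial] at hE
    have := h.finite
    -- A nonzero finitely generated Ext^{t+1}(M, C) maps onto k, and k maps nontrivially to Ext^t(k,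
    -- C); the composite contradicts `linearMap_ext_eq_zero`.
    obtain ⟨N, ⟨e⟩⟩ := exists_submodule_quotient_equiv_residueField (R := R)
      (Ext (ModuleCat.of R M) (ModuleCat.of R C) (t + 1))
    obtain ⟨ψ, hψ⟩ := @exists_ne _ (IsFiniteLength.nontrivial_linearMap
      (M := ModuleCat.of R (Ext (ModuleCat.of R (ResidueField R)) (ModuleCat.of R C) t))
      (isFiniteLength_ext_residueField (ModuleCat.of R C) t)) 0
    refine hψ (LinearMap.ext fun z => ?_)
    obtain ⟨y, rfl⟩ := (e.surjective.comp N.mkQ_surjective) z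
    exact LinearMap.congr_fun (h.linearMap_ext_eq_zero hC (ψ ∘ₗ e.toLinearMap ∘ₗ N.mkQ)) y

variable {M : Type u} [AddCommGroup M] [Module R M] (hM : IsFiniteLength R M)
  (h : HasReflexiveResolution R C t M)

include h

omit [IsLocalRing R] hC in
lemma HasReflexiveResolution.nonempty_linearMap_equiv {X : Type u} [AddCommGroup X] [Module R X]
    (hX : ∀ i < t, Subsingleton (Ext (ModuleCat.of R X) (ModuleCat.of R C) i)) :
    Nonempty ((X →ₗ[R] M) ≃ₗ[R] (Ext (ModuleCat.of R M) (ModuleCat.of R C) t →ₗ[R]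
      Ext (ModuleCat.of R X) (ModuleCat.of R C) t)) :=
  ⟨(Ext.zeroEquivLinearMap X M).symm.trans
    (LinearEquiv.ofBijective _ (h.pairing_bijective hX (zero_add t)))⟩

/-- If a module of finite `G_C`-dimension has a one-dimensional socle, so has `C`, in degree
`depth C`. -/
lemma HasReflexiveResolution.length_ext_eq_one
    (hC' : Nontrivial (Ext (ModuleCat.of R (ResidueField R)) (ModuleCat.of R C) t))
    (hsoc : Module.length R (ResidueField R →ₗ[R] M) = 1) :
    Module.length R (Ext (ModuleCat.of R (ResidueField R)) (ModuleCat.of R C) t) = 1 := by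
  obtain ⟨e⟩ := h.nonempty_linearMap_equiv hC
  rw [e.length_eq] at hsoc
  have := h.finite
  have hE : Nontrivial (Ext (ModuleCat.of R M) (ModuleCat.of R C) t) := by
    by_contra hE
    rw [not_nontrivial_iff_subsingleton] at hE
    have : Subsingleton (Ext (ModuleCat.of R M) (ModuleCat.of R C) t →ₗ[R]
      Ext (ModuleCat.of R (ResidueField R)) (ModuleCat.of R C) t) :=
        subsingleton_of_forall_eq 0 fun f => LinearMap.ext fun x => by
          rw [Subsingleton.elim x 0, map_zero, map_zero]
    rw [Module.length_eq_zero] at hsoc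
    exact zero_ne_one hsoc
  -- Since Ext^t(M, C) maps onto k, Ext^t(k, C) ≅ Hom(k, Ext^t(k, C)) embeds in a module of length
  -- one.
  obtain ⟨N, ⟨e'⟩⟩ := exists_submodule_quotient_equiv_residueField (R := R)
    (Ext (ModuleCat.of R M) (ModuleCat.of R C) t)
  have hsurj := e'.surjective.comp N.mkQ_surjective
  obtain ⟨ε⟩ := nonempty_quotient_linearMap_equiv (V := Ext (ModuleCat.of R (ResidueField R))
    (ModuleCat.of R C) t) (maximalIdeal_le_annihilator_ext (ModuleCat.of R C) t)
  refine le_antisymm ?_ (Order.one_le_iff_ne_zero.2 fun h0 => ?_)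
  · rw [← hsoc, ← ε.length_eq]
    exact Module.length_le_of_injective ((e'.toLinearMap ∘ₗ N.mkQ).lcomp R _)
      (LinearMap.lcomp_injective_of_surjective _ hsurj)
  · rw [Module.length_eq_zero_iff] at h0
    exact not_subsingleton _ h0

include hM

/-- If `C` has type one and a nonzero module of finite length and finite `G_C`-dimension exists,
then `Ext^i(k, C) = 0` for all `i > depth C`. -/
lemma HasReflexiveResolution.subsingleton_ext_residueField [Nontrivial M]
    (hC' : Module.length R (Ext (ModuleCat.of R (ResidueField R)) (ModuleCat.of R C) t) = 1)
    (i : ℕ) (hi : t < i) :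
    Subsingleton (Ext (ModuleCat.of R (ResidueField R)) (ModuleCat.of R C) i) := by
  have := h.finite
  obtain ⟨n, hn⟩ := hM.exists_pow_smul_eq_zero (M := ModuleCat.of R M)
  have hJ : IsFiniteLength R (R ⧸ maximalIdeal R ^ n) := isFiniteLength_quotient_of_pow_le le_rfl
  have hn0 : n ≠ 0 := by
    rintro rfl
    rw [pow_zero, Ideal.one_eq_top, top_le_iff, Module.annihilator_eq_top_iff] at hn
    exact not_subsingleton M hn
  -- As m^n kills M, M ≅ Hom(R/m^n, M), which the pairing identifies with Hom(Ext^t(M, C),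
  -- Ext^t(R/m^n, C)); type one bounds the socle of the target by one.
  obtain ⟨e₁⟩ := nonempty_quotient_linearMap_equiv hn
  obtain ⟨e₂⟩ := h.nonempty_linearMap_equiv fun i hi =>
    hJ.subsingleton_ext (X := ModuleCat.of R (R ⧸ maximalIdeal R ^ n)) (hC i hi)
  have hE : IsFiniteLength R (Ext (ModuleCat.of R M) (ModuleCat.of R C) t) := hM.ext t
  have hle : Module.length R M ≤
      Module.length R (Ext (ModuleCat.of R M) (ModuleCat.of R C) t) := by
    calc Module.length R M = _ := e₁.length_eq.symm.trans e₂.length_eq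
      _ ≤ _ := hE.length_linearMap_le
      _ ≤ Module.length R (Ext (ModuleCat.of R M) (ModuleCat.of R C) t) * 1 := by
        gcongr
        rw [← hC']
        exact length_linearMap_ext_quotient_le hC hJ (Ideal.pow_le_self hn0)
      _ = _ := mul_one _
  obtain ⟨N, ⟨e⟩⟩ := exists_submodule_quotient_equiv_residueField (R := R) M
  have hN : IsFiniteLength R N := hM.of_injective N.injective_subtype
  have hS := N.shortExact
  -- restriction `Ext^t(M, C) → Ext^t(N, C)` is surjective for reasons of length
  let r : Ext (ModuleCat.of R M) (ModuleCat.of R C) t →ₗ[R]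
      Ext (ModuleCat.of R N) (ModuleCat.of R C) t :=
    (Ext.mk₀ (ModuleCat.ofHom N.subtype)).precompOfLinear R (ModuleCat.of R C) (zero_add t)
  have hE' : IsFiniteLength R (Ext (ModuleCat.of R N) (ModuleCat.of R C) t) := hN.ext t
  have hr : LinearMap.range r = ⊤ := by
    -- Here length N + 1 = length M ≤ length Ext^t(M, C) ≤ 1 + length (range r), while length
    -- Ext^t(N, C) ≤ length N because C has type one.
    by_contra hne
    obtain ⟨_, _⟩ := isFiniteLength_iff_isNoetherian_isArtinian.1 hE'
    have hlt := Submodule.length_lt hne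
    have h1 : Module.length R (Ext (ModuleCat.of R N) (ModuleCat.of R C) t) ≤ Module.length R N := by
      simpa [hC'] using hN.length_ext_le (Y := ModuleCat.of R C) (X := ModuleCat.of R N) t
    have hex : Function.Exact ((Ext.mk₀ (ModuleCat.ofHom N.mkQ)).precompOfLinear R
        (ModuleCat.of R C) (zero_add t)) r.rangeRestrict := fun x => by
      rw [← hS.exact_precomp_g_precomp_f (ModuleCat.of R C) t x, Subtype.ext_iff]
      rfl
    have h2 := LinearMap.length_le_add_of_exact hex
    rw [show Module.length R (Ext (ModuleCat.of R (M ⧸ N)) (ModuleCat.of R C) t) = 1 from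
      (Ext.congrLeft e (ModuleCat.of R C) t).symm.length_eq.trans hC'] at h2
    have h3 := hle.trans h2
    rw [Module.length_submodule_add_one e, add_comm] at h3
    have h4 : Module.length R N ≤ Module.length R (LinearMap.range r) :=
      (ENat.add_le_add_iff_left ENat.one_ne_top).1 h3
    exact absurd (h4.trans_lt (hlt.trans_le h1)) (lt_irrefl _)
  have hstep (i : ℕ) (hi : t < i) (h' : Subsingleton (Ext (ModuleCat.of R (M ⧸ N))
      (ModuleCat.of R C) i)) : Subsingleton (Ext (ModuleCat.of R (ResidueField R))
        (ModuleCat.of R C) i) := (Ext.congrLeft e (ModuleCat.of R C) i).subsingleton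
  induction i, hi using Nat.le_induction with
  | base =>
    -- As Ext^{t+1}(M, C) = 0, every class comes from Ext^t(N, C) by the connecting map, which kills
    -- restrictions from M, and these are everything.
    refine hstep _ (by omega) (subsingleton_of_forall_eq 0 fun z => ?_)
    obtain ⟨y, rfl⟩ := Ext.contravariant_sequence_exact₃ hS (ModuleCat.of R C) z
      ((h.subsingleton_ext (t + 1) (by omega)).elim _ _) (add_comm 1 t)
    obtain ⟨x, rfl⟩ := LinearMap.range_eq_top.1 hr y
    exact hS.extClass_comp_assoc x
  | succ i hi ih =>
    exact hstep _ (by omega) (hS.subsingleton_ext_X₃ (add_comm 1 i)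
      (hN.subsingleton_ext (X := ModuleCat.of R N) ih) (h.subsingleton_ext _ (by omega)))

omit h hM [Module.Finite R C] hC in
lemma injectiveDimension_lt_top_of_residueField [Module.Finite R C]
    (h : ∀ i, t < i → Subsingleton (Ext (ModuleCat.of R (ResidueField R)) (ModuleCat.of R C) i)) :
    injectiveDimension (ModuleCat.of R C) < ⊤ := by
  refine lt_of_lt_of_le (injectiveDimension_lt_iff (n := t + 1).2 ?_) le_top
  exact hasInjectiveDimensionLT_of_forall_finite t _ fun X _ =>
    subsingleton_ext_of_residueField (n := t + 1) (fun i hi => h i hi) X (t + 1) le_rfl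

end FiniteLengthDuality

/-! ### A dualizing module modulo a maximal regular sequence. -/

section DualizingQuotient

open IsLocalRing RingTheory.Sequence

variable {R : Type u} [CommRing R] [IsLocalRing R] [IsNoetherianRing R]

/-- A bound on the degrees in which `Ext(W, Y)` is nonzero is one for `Ext(k, Y)` if `k` embeds in
`W` and `Ext^i(k, Y) = 0` for large `i`. -/
lemma subsingleton_ext_residueField_of_injective {Y : ModuleCat.{u} R} [Module.Finite R Y]
    {W : Type u} [AddCommGroup W] [Module R W] [Module.Finite R W] {j : ResidueField R →ₗ[R] W}
    (hj : Function.Injective j) {t m : ℕ}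
    (hW : ∀ i, t < i → Subsingleton (Ext (ModuleCat.of R W) Y i))
    (hm : ∀ i, t + m < i → Subsingleton (Ext (ModuleCat.of R (ResidueField R)) Y i))
    (i : ℕ) (hi : t < i) : Subsingleton (Ext (ModuleCat.of R (ResidueField R)) Y i) := by
  induction m generalizing i with
  | zero => exact hm i hi
  | succ m ih =>
    refine ih (fun i hi => ?_) i hi
    -- Ext^i(k, Y) lies between Ext^i(W, Y) = 0 and Ext^{i+1}(W/k, Y). The latter vanishes by the
    -- current bound, which thus drops by one.
    have hS := (LinearMap.exact_map_mkQ_range j).shortExact hj (LinearMap.range j).mkQ_surjective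
    refine hS.subsingleton_ext_X₁ (add_comm 1 i) (hW i (by omega)) ?_
    exact subsingleton_ext_of_residueField (n := t + (m + 1) + 1)
      (fun i hi => hm i (by omega)) (ModuleCat.of R (W ⧸ LinearMap.range j)) (i + 1) (by omega)

omit [IsLocalRing R] [IsNoetherianRing R] in
lemma Ideal.eq_of_length_quotient_eq {I J : Ideal R} (h : I ≤ J) (hI : IsFiniteLength R (R ⧸ I))
    (hl : Module.length R (R ⧸ I) = Module.length R (R ⧸ J)) : I = J := by
  have hex := Module.length_eq_add_of_exact (LinearMap.ker (Submodule.factor h)).subtype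
    (Submodule.factor h) (Submodule.injective_subtype _) (Submodule.factor_surjective h)
    (LinearMap.exact_subtype_ker_map _)
  have hfin := Module.length_ne_top_iff.2 hI
  rw [hl] at hex hfin
  have h0 : Module.length R (LinearMap.ker (Submodule.factor h)) = 0 := by
    by_contra h0
    have : Module.length R (R ⧸ J) + 1 ≤ Module.length R (R ⧸ J) := by
      conv_rhs => rw [hex]
      rw [add_comm]
      gcongr
      exact Order.one_le_iff_ne_zero.2 h0
    exact (ENat.add_one_le_iff hfin).1 this |>.false.elim
  rw [Module.length_eq_zero_iff, Submodule.subsingleton_iff_eq_bot, LinearMap.ker_eq_bot] at h0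
  refine le_antisymm h fun x hx => ?_
  rw [← Ideal.Quotient.eq_zero_iff_mem] at hx ⊢
  exact h0 (hx.trans (map_zero _).symm)

/-- If `length Hom(X, W) = r * length X` for all quotients `X` of `R ⧸ J` of finite length, then
`R ⧸ J` has finite length, by Nakayama's lemma. -/
lemma isFiniteLength_of_length_linearMap_eq {W : Type u} [AddCommGroup W] [Module R W]
    [Module.Finite R W] {J : Ideal R} {r : ℕ∞} (hr : r ≠ 0) (hr' : r ≠ ⊤)
    (h : ∀ I : Ideal R, J ≤ I → IsFiniteLength R (R ⧸ I) →
      Module.length R ((R ⧸ I) →ₗ[R] W) = r * Module.length R (R ⧸ I)) :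
    IsFiniteLength R (R ⧸ J) := by
  let I (n : ℕ) : Ideal R := J ⊔ maximalIdeal R ^ n
  have hI (n : ℕ) : IsFiniteLength R (R ⧸ I n) := isFiniteLength_quotient_of_pow_le le_sup_right
  have hle (n : ℕ) : I (n + 1) ≤ I n := sup_le_sup_left (Ideal.pow_le_pow_right n.le_succ) J
  let ev (n : ℕ) : ((R ⧸ I n) →ₗ[R] W) →ₗ[R] W := LinearMap.applyₗ (Ideal.Quotient.mk (I n) 1)
  have hev (n : ℕ) : Function.Injective (ev n) := fun f g hfg =>
    Submodule.linearMap_qext _ (LinearMap.ext_ring hfg)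
  -- T n consists of the elements of W killed by I n. The chain is stationary since W is Noetherian,
  -- and the length formula turns this into I n = I (n + 1).
  let T : ℕ →o Submodule R W := ⟨fun n => LinearMap.range (ev n), monotone_nat_of_le_succ fun n => by
    rintro _ ⟨f, rfl⟩
    exact ⟨f ∘ₗ Submodule.factor (hle n), rfl⟩⟩
  obtain ⟨n, hn⟩ := monotone_stabilizes_iff_noetherian.2 (inferInstance : IsNoetherian R W) T
  have hT : LinearMap.range (ev n) = LinearMap.range (ev (n + 1)) := hn (n + 1) n.le_succ
  have hlen : Module.length R (R ⧸ I (n + 1)) = Module.length R (R ⧸ I n) := by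
    have h1 := (LinearEquiv.ofInjective _ (hev n)).length_eq
    have h2 := (LinearEquiv.ofInjective _ (hev (n + 1))).length_eq
    rw [h _ le_sup_left (hI n), hT, ← h2, h _ le_sup_left (hI (n + 1))] at h1
    exact ((ENat.mul_right_strictMono hr hr').injective h1).symm
  have heq := Ideal.eq_of_length_quotient_eq (hle n) (hI (n + 1)) hlen
  refine isFiniteLength_quotient_of_pow_le (n := n) ?_
  refine Submodule.le_of_le_smul_of_le_jacobson_bot (I := maximalIdeal R)
    (IsNoetherian.noetherian _) (maximalIdeal_le_jacobson _) ?_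
  calc maximalIdeal R ^ n ≤ I (n + 1) := heq ▸ le_sup_right
    _ = _ := by rw [smul_eq_mul, ← pow_succ']

omit [IsLocalRing R] [IsNoetherianRing R] in
lemma IsSemidualizing.nontrivial [Nontrivial R] {D : Type u} [AddCommGroup D] [Module R D]
    (h : IsSemidualizing R D) : Nontrivial D := by
  by_contra hD
  rw [not_nontrivial_iff_subsingleton] at hD
  refine one_ne_zero (α := R) (h.homothety_bijective.1 (LinearMap.ext fun x => Subsingleton.elim _ _))

/-- A dualizing module `D` has a maximal regular sequence `ys` such that `D ⧸ ys D` is a module of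
finite length with a one-dimensional socle. -/
theorem IsDualizing.exists_isRegular {D : Type u} [AddCommGroup D] [Module R D]
    (hD : IsDualizing R D) : ∃ ys : List R, (∀ y ∈ ys, y ∈ maximalIdeal R) ∧ IsRegular D ys ∧
      IsFiniteLength R (D ⧸ (Ideal.ofList ys • ⊤ : Submodule R D)) ∧
      Module.length R (ResidueField R →ₗ[R] D ⧸ (Ideal.ofList ys • ⊤ : Submodule R D)) = 1 := by
  have := hD.semidualizing.finite
  have := IsSemidualizing.nontrivial hD.semidualizing
  obtain ⟨ys, hym, hreg, -, hlt, hnt, ⟨e⟩⟩ := exists_isRegular_moduleDepth_eq (R := R) D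
  have hreg' := hreg.toIsWeaklyRegular
  let W := D ⧸ (Ideal.ofList ys • ⊤ : Submodule R D)
  let J := Ideal.ofList ys
  let r := Module.length R (Ext (ModuleCat.of R (ResidueField R)) (ModuleCat.of R D) ys.length)
  have hr : r ≠ 0 := fun h => not_subsingleton _ (Module.length_eq_zero_iff.1 h)
  have hr' : r ≠ ⊤ := Module.length_ne_top_iff.2 (isFiniteLength_ext_residueField _ _)
  have hJW : J ≤ Module.annihilator R W := fun x hx => Module.mem_annihilator.2 fun w => by
    obtain ⟨d, rfl⟩ := Submodule.mkQ_surjective _ w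
    rw [← map_smul, Submodule.mkQ_apply, Submodule.Quotient.mk_eq_zero]
    exact Submodule.smul_mem_smul hx trivial
  have hWnt : Nontrivial W := hreg.quot_ofList_smul_nontrivial ⊤
  -- Semidualizing means Hom(D, D) = R with no higher Ext, so Ext^i(W, D) is concentrated in degrees
  -- at most the depth, with top term R/J.
  obtain ⟨h1, ⟨e₁⟩⟩ := hreg'.ext_quotient_eq (ModuleCat.of R D) ys D R 0
    ((Ext.zeroEquivLinearMap D D).trans
      (LinearEquiv.ofBijective _ hD.semidualizing.homothety_bijective).symm)
    hD.semidualizing.ext_eq_zero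
  rw [zero_add] at h1 e₁
  obtain ⟨j₀, hj₀⟩ : ∃ j : ResidueField R →ₗ[R] W, j ≠ 0 := by
    have := e.symm.toEquiv.nontrivial
    exact exists_ne 0
  obtain ⟨N, hN⟩ : ∃ N : ℕ, HasInjectiveDimensionLT (ModuleCat.of R D) N := by
    obtain ⟨n, hn⟩ := (injectiveDimension_ne_top_iff _).1 hD.injectiveDimension_lt_top.ne
    exact ⟨n + 1, hn⟩
  -- Finite injective dimension gives only a crude bound. It sharpens to the depth because k embeds
  -- in W and Ext^i(W, D) vanishes above the depth.
  have hExt : ∀ i, ys.length < i →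
      Subsingleton (Ext (ModuleCat.of R (ResidueField R)) (ModuleCat.of R D) i) :=
    subsingleton_ext_residueField_of_injective (W := W) (m := N)
      (LinearMap.injective_of_ne_zero hj₀) h1
      fun i hi => HasInjectiveDimensionLT.subsingleton _ N i (by omega) _
  have hlen {X : Type u} [AddCommGroup X] [Module R X] (hX : IsFiniteLength R X) :
      Module.length R (Ext (ModuleCat.of R X) (ModuleCat.of R D) ys.length) =
        Module.length R X * r :=
    IsFiniteLength.length_ext_eq (X := ModuleCat.of R X) hX hlt (hExt _ (Nat.lt_succ_self _))
  have hhom {X : Type u} [AddCommGroup X] [Module R X] (hX : J ≤ Module.annihilator R X) :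
      Nonempty (Ext (ModuleCat.of R X) (ModuleCat.of R D) ys.length ≃ₗ[R] (X →ₗ[R] W)) :=
    (hreg'.ext_eq X ys (fun y hy => Module.mem_annihilator.1
      (hX (Ideal.subset_span hy))) D).2
  have hJ : IsFiniteLength R (R ⧸ J) := by
    refine isFiniteLength_of_length_linearMap_eq hr hr' (W := W) fun I hI hIf => ?_
    obtain ⟨e'⟩ := hhom (X := R ⧸ I) (by rwa [Ideal.annihilator_quotient])
    rw [← e'.length_eq, hlen hIf, mul_comm]
  obtain ⟨n, hn⟩ := hJ.exists_pow_smul_eq_zero (M := ModuleCat.of R (R ⧸ J))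
  have hW : IsFiniteLength R W := isFiniteLength_of_pow_le_annihilator W n
    (hn.trans ((Ideal.annihilator_quotient (I := J)).trans_le hJW))
  refine ⟨ys, hym, hreg, hW, e.length_eq.symm.trans ?_⟩
  change r = 1
  have hb : Module.length R W = Module.length R (R ⧸ J) * r := by
    obtain ⟨e'⟩ := hhom (X := R ⧸ J) (by rw [Ideal.annihilator_quotient])
    obtain ⟨e''⟩ := nonempty_quotient_linearMap_equiv hJW
    rw [← e''.length_eq, ← e'.length_eq, hlen hJ]
  have ha : Module.length R (R ⧸ J) = Module.length R W * r := by
    rw [← hlen hW, e₁.length_eq, smul_eq_mul, Ideal.mul_top]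
  have hb0 : Module.length R W ≠ 0 := fun h => not_subsingleton _ (Module.length_eq_zero_iff.1 h)
  -- Two opposite counts: W ≅ Hom(R/J, W) gives length W = r · length R/J, and Ext(W, D) ≅ R/J in
  -- degree the depth gives length R/J = r · length W.
  have hrr : r * r = 1 := by
    have h2 : Module.length R W * 1 = Module.length R W * (r * r) := by
      rw [mul_one, ← mul_assoc, ← ha, ← hb]
    exact ((ENat.mul_right_strictMono hb0 (Module.length_ne_top_iff.2 hW)).injective h2).symm
  obtain ⟨m, hm⟩ := ENat.ne_top_iff_exists.1 hr'
  rw [← hm] at hrr ⊢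
  norm_cast at hrr ⊢
  exact Nat.eq_one_of_mul_eq_one_right hrr

end DualizingQuotient

/-! ### Stability of finite G_C-dimension. -/

section GCDimension

open RingTheory.Sequence

variable {R : Type u} [CommRing R] {C : Type u} [AddCommGroup C] [Module R C]

lemma Ext.subsingleton_prod {A B : Type u} [AddCommGroup A] [Module R A] [AddCommGroup B]
    [Module R B] {Y : ModuleCat.{u} R} {n : ℕ} (hA : Subsingleton (Ext (ModuleCat.of R A) Y n))
    (hB : Subsingleton (Ext (ModuleCat.of R B) Y n)) :
    Subsingleton (Ext (ModuleCat.of R (A × B)) Y n) :=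
  (Function.Exact.inl_snd.shortExact (R := R) (f := LinearMap.inl R A B) LinearMap.inl_injective
    LinearMap.snd_surjective).subsingleton_ext_X₂ hA hB

namespace IsTotallyReflexive

lemma prod {A B : Type u} [AddCommGroup A] [Module R A] [AddCommGroup B] [Module R B]
    (hA : IsTotallyReflexive R C A) (hB : IsTotallyReflexive R C B) :
    IsTotallyReflexive R C (A × B) where
  finite := by
    have := hA.finite
    have := hB.finite
    infer_instance
  evaluation_bijective := by
    refine ⟨(injective_iff_map_eq_zero _).2 fun x hx => ?_, fun φ => ?_⟩
    · refine Prod.ext ?_ ?_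
      · refine (injective_iff_map_eq_zero _).1 hA.evaluation_bijective.1 _ (LinearMap.ext fun f => ?_)
        exact LinearMap.congr_fun hx (f ∘ₗ LinearMap.fst R A B)
      · refine (injective_iff_map_eq_zero _).1 hB.evaluation_bijective.1 _ (LinearMap.ext fun f => ?_)
        exact LinearMap.congr_fun hx (f ∘ₗ LinearMap.snd R A B)
    · obtain ⟨a, ha⟩ := hA.evaluation_bijective.2 (φ ∘ₗ (LinearMap.fst R A B).lcomp R C)
      obtain ⟨b, hb⟩ := hB.evaluation_bijective.2 (φ ∘ₗ (LinearMap.snd R A B).lcomp R C)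
      refine ⟨(a, b), LinearMap.ext fun f => ?_⟩
      have h1 : f (a, 0) = φ (f ∘ₗ LinearMap.inl R A B ∘ₗ LinearMap.fst R A B) :=
        LinearMap.congr_fun ha (f ∘ₗ LinearMap.inl R A B)
      have h2 : f (0, b) = φ (f ∘ₗ LinearMap.inr R A B ∘ₗ LinearMap.snd R A B) :=
        LinearMap.congr_fun hb (f ∘ₗ LinearMap.inr R A B)
      change f (a, b) = φ f
      rw [show (a, b) = (a, 0) + (0, b) by simp, map_add, h1, h2, ← map_add]
      congr 1
      ext x
      all_goals simp [show f (0, 0) = 0 from map_zero f]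
  ext_eq_zero i hi := Ext.subsingleton_prod (hA.ext_eq_zero i hi) (hB.ext_eq_zero i hi)
  ext_hom_eq_zero i hi := by
    have := Ext.subsingleton_prod (hA.ext_hom_eq_zero i hi) (hB.ext_hom_eq_zero i hi)
    exact (Ext.congrLeft (LinearMap.coprodEquiv R) (ModuleCat.of R C) i).subsingleton

end IsTotallyReflexive

/-- The dual of C is R by homothety, so a functional on it is determined by its value at the
identity, and its higher Ext vanish as R is free. -/
lemma IsSemidualizing.isTotallyReflexive (hC : IsSemidualizing R C) : IsTotallyReflexive R C C where
  finite := hC.finite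
  evaluation_bijective := by
    refine ⟨fun x y h => LinearMap.congr_fun h LinearMap.id, fun φ =>
      ⟨φ LinearMap.id, LinearMap.ext fun f => ?_⟩⟩
    obtain ⟨r, rfl⟩ := hC.homothety_bijective.2 f
    change r • φ LinearMap.id = _
    rw [← map_smul]
    rfl
  ext_eq_zero := hC.ext_eq_zero
  ext_hom_eq_zero i hi := by
    obtain ⟨i, rfl⟩ : ∃ j, i = j + 1 := ⟨i - 1, by omega⟩
    have : Projective (ModuleCat.of R R) := ModuleCat.projective_of_free (Module.Basis.singleton Unit R)
    have := Ext.subsingleton_of_projective (ModuleCat.of R R) (ModuleCat.of R C) i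
    exact (Ext.congrLeft (LinearEquiv.ofBijective _ hC.homothety_bijective)
      (ModuleCat.of R C) (i + 1)).subsingleton

lemma gcDim_lt_top_iff {M : Type u} [AddCommGroup M] [Module R M] :
    gcDim R C M < ⊤ ↔ ∃ n, HasGCDimLE R C M n := by
  simp only [gcDim, iInf_lt_iff]
  exact exists_congr fun n => ⟨fun h => h.1, fun h => ⟨h, ENat.natCast_lt_top n⟩⟩

namespace HasGCDimLE

variable {M N : Type u} [AddCommGroup M] [Module R M] [AddCommGroup N] [Module R N] {n : ℕ}

lemma of_linearEquiv (e : M ≃ₗ[R] N) (h : HasGCDimLE R C M n) : HasGCDimLE R C N n := by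
  obtain ⟨G, d, ε, hG, hG', hε, hd, hd'⟩ := h
  refine ⟨G, d, e.toLinearMap ∘ₗ ε, hG, hG', e.surjective.comp hε, fun x => ?_, hd'⟩
  rw [← hd x]
  exact e.map_eq_zero_iff

lemma of_subsingleton [Subsingleton M] : HasGCDimLE R C M 0 :=
  ⟨fun _ => ModuleCat.of R PUnit, fun _ => 0, 0,
    fun _ _ => IsTotallyReflexive.of_subsingleton PUnit.{u + 1}, fun _ _ => inferInstanceAs (Subsingleton PUnit),
    fun _ => ⟨0, Subsingleton.elim _ _⟩,
    fun _ => ⟨fun _ => ⟨0, rfl⟩, fun _ => Subsingleton.elim _ _⟩,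
    fun _ _ => ⟨fun _ => ⟨0, rfl⟩, fun _ => rfl⟩⟩

lemma of_exact {K G : Type u} [AddCommGroup K] [Module R K] [AddCommGroup G] [Module R G]
    {f : K →ₗ[R] G} {g : G →ₗ[R] M} (hf : Function.Injective f) (hg : Function.Surjective g)
    (hfg : Function.Exact f g) (hG : IsTotallyReflexive R C G) (h : HasGCDimLE R C K n) :
    HasGCDimLE R C M (n + 1) := by
  obtain ⟨F, d, ε, hF, hF', hε, hd, hd'⟩ := h
  refine ⟨fun i => match i with
      | 0 => ModuleCat.of R G
      | i + 1 => F i,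
    fun i => match i with
      | 0 => f ∘ₗ ε
      | i + 1 => d i, g, ?_, ?_, hg, ?_, ?_⟩
  · rintro (_ | i) hi
    · exact hG
    · exact hF i (by omega)
  · rintro (_ | i) hi
    · omega
    · exact hF' i (by omega)
  · intro x
    rw [hfg x]
    exact ⟨fun ⟨y, hy⟩ => (hε y).imp fun z hz => by rw [← hy, ← hz]; rfl, fun ⟨z, hz⟩ => ⟨ε z, hz⟩⟩
  · rintro (_ | i)
    · intro x
      rw [← hd x]
      exact map_eq_zero_iff f hf
    · exact hd' i

/-- The mapping cone of multiplication by `x` on a resolution of `M` resolves `M / x M`. -/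
lemma of_isSMulRegular {x : R} (hx : IsSMulRegular M x) (h : HasGCDimLE R C M n) :
    HasGCDimLE R C (QuotSMulTop x M) (n + 1) := by
  obtain ⟨G, d, ε, hG, hG', hε, hd, hd'⟩ := h
  have hdd (i : ℕ) (y : G (i + 2)) : d i (d (i + 1) y) = 0 := (hd' i).apply_apply_eq_zero y
  have hεd (y : G 1) : ε (d 0 y) = 0 := hd.apply_apply_eq_zero y
  -- The alternating sign makes consecutive differentials of the cone compose to zero.
  let s (i : ℕ) : R := (-1) ^ i * x
  have hs0 : s 0 = x := by simp only [s, pow_zero, one_mul]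
  have hs (i : ℕ) : s (i + 1) = - s i := by simp only [s]; ring
  refine ⟨fun i => match i with
      | 0 => G 0
      | i + 1 => ModuleCat.of R (G (i + 1) × G i),
    fun i => match i with
      | 0 => (d 0).coprod (s 0 • LinearMap.id)
      | i + 1 => ((d (i + 1)).coprod (s (i + 1) • LinearMap.id)).prod (d i ∘ₗ LinearMap.snd R _ _),
    Submodule.mkQ _ ∘ₗ ε, ?_, ?_, (Submodule.mkQ_surjective _).comp hε, ?_, ?_⟩
  · rintro (_ | i) hi
    · exact hG 0 (by omega)
    · by_cases hi' : i + 1 ≤ n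
      · exact (hG (i + 1) hi').prod (hG i (by omega))
      · have := hG' (i + 1) (by omega)
        exact (IsTotallyReflexive.of_subsingleton (G (i + 1))).prod (hG i (by omega))
  · rintro (_ | i) hi
    · omega
    · have := hG' (i + 1) (by omega)
      have := hG' i (by omega)
      exact inferInstanceAs (Subsingleton (G (i + 1) × G i))
  · intro y
    change Submodule.Quotient.mk (ε y) = 0 ↔ ∃ p : G 1 × G 0, d 0 p.1 + s 0 • p.2 = y
    rw [Submodule.Quotient.mk_eq_zero, Submodule.mem_smul_pointwise_iff_exists, hs0]
    constructor
    · rintro ⟨m, -, hm⟩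
      obtain ⟨z, rfl⟩ := hε m
      obtain ⟨w, hw⟩ := (hd (y - x • z)).1 (by rw [map_sub, map_smul, hm, sub_self])
      exact ⟨(w, z), by rw [hw, sub_add_cancel]⟩
    · rintro ⟨p, rfl⟩
      exact ⟨ε p.2, trivial, by rw [map_add, hεd, zero_add, map_smul]⟩
  · rintro (_ | i)
    · rintro ⟨a, b⟩
      change d 0 a + s 0 • b = 0 ↔
        ∃ p : G 2 × G 1, (d 1 p.1 + s 1 • p.2, d 0 p.2) = (a, b)
      constructor
      · intro h
        have hb : ε b = 0 := hx (by
          change x • ε b = x • (0 : M)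
          rw [smul_zero, ← map_smul, ← hs0, ← zero_add (ε _)]
          conv_lhs => rw [← hεd a]
          rw [← map_add, h, map_zero])
        obtain ⟨b, rfl⟩ := (hd b).1 hb
        obtain ⟨p, hp⟩ := (hd' 0 (a + s 0 • b)).1 (by rw [map_add, map_smul, h])
        exact ⟨(p, b), Prod.ext (by rw [hp, hs, neg_smul, add_neg_cancel_right]) rfl⟩
      · rintro ⟨p, hp⟩
        obtain ⟨rfl, rfl⟩ := Prod.ext_iff.1 hp
        rw [map_add, hdd, map_smul, zero_add, hs, neg_smul, neg_add_cancel]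
    · rintro ⟨a, b⟩
      change (d (i + 1) a + s (i + 1) • b, d i b) = 0 ↔
        ∃ p : G (i + 3) × G (i + 2), (d (i + 2) p.1 + s (i + 2) • p.2, d (i + 1) p.2) = (a, b)
      constructor
      · intro h
        obtain ⟨h, hb⟩ := Prod.ext_iff.1 h
        obtain ⟨b, rfl⟩ := (hd' i b).1 hb
        obtain ⟨p, hp⟩ := (hd' (i + 1) (a + s (i + 1) • b)).1 (by rw [map_add, map_smul]; exact h)
        exact ⟨(p, b), Prod.ext (by rw [hp, hs (i + 1), neg_smul, add_neg_cancel_right]) rfl⟩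
      · rintro ⟨p, hp⟩
        obtain ⟨rfl, rfl⟩ := Prod.ext_iff.1 hp
        refine Prod.ext ?_ (hdd i p.2)
        change d (i + 1) (d (i + 2) p.1 + s (i + 2) • p.2) + s (i + 1) • d (i + 1) p.2 = 0
        rw [map_add, hdd, map_smul, zero_add, hs, neg_smul, neg_add_cancel]

lemma of_isWeaklyRegular (rs : List R) (hrs : IsWeaklyRegular M rs) (h : HasGCDimLE R C M n) :
    HasGCDimLE R C (M ⧸ (Ideal.ofList rs • ⊤ : Submodule R M)) (n + rs.length) := by
  induction rs generalizing M n with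
  | nil =>
    exact h.of_linearEquiv (Submodule.quotEquivOfEqBot (Ideal.ofList ([] : List R) • ⊤ : Submodule R M)
        (by rw [Ideal.ofList_nil, Submodule.bot_smul])).symm
  | cons r rs ih =>
    rw [isWeaklyRegular_cons_iff] at hrs
    have := (ih hrs.2 (h.of_isSMulRegular hrs.1)).of_linearEquiv
      (Submodule.quotOfListConsSMulTopEquivQuotSMulTopInner M r rs).symm
    rwa [List.length_cons, add_comm rs.length, ← add_assoc]

end HasGCDimLE

end GCDimension

/-! ### Descent from a quotient ring to R. -/

section QuotientRing

open IsLocalRing RingTheory.Sequence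

variable {R : Type u} [CommRing R] {S : Type u} [CommRing S] [Algebra R S]
  {W : Type u} [AddCommGroup W] [Module R W] [Module S W] [IsScalarTower R S W]
  (hRS : Function.Surjective (algebraMap R S))

include hRS

lemma IsFiniteLength.of_surjective_algebraMap (hW : IsFiniteLength S W) : IsFiniteLength R W := by
  rw [← Module.length_ne_top_iff, Module.length_eq_of_surjective hRS]
  exact Module.length_ne_top_iff.2 hW

/-- R and S share their residue field, and R-linear maps between S-modules are S-linear because R →
S is onto. -/
lemma length_residueField_linearMap_of_surjective [IsLocalRing R] [IsLocalRing S] :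
    Module.length R (ResidueField R →ₗ[R] W) = Module.length S (ResidueField S →ₗ[S] W) := by
  have : IsSimpleModule R (ResidueField S) := by
    rw [← Module.length_eq_one_iff, Module.length_eq_of_surjective hRS,
      Module.length_eq_one S (ResidueField S)]
  obtain ⟨e⟩ := nonempty_equiv_residueField (R := R) (ResidueField S)
  rw [← Module.length_eq_of_surjective (S := R) hRS,
    ← (e.arrowCongr (LinearEquiv.refl R W)).length_eq]
  refine (LinearEquiv.ofBijective
    (LinearMap.restrictScalarsₗ R S (ResidueField S) W R)
    ⟨LinearMap.restrictScalars_injective R, fun f => ?_⟩).length_eq.symm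
  refine ⟨⟨f.toAddHom, fun s z => ?_⟩, rfl⟩
  obtain ⟨r, rfl⟩ := hRS s
  change f (algebraMap R S r • z) = algebraMap R S r • f z
  rw [algebraMap_smul, algebraMap_smul, map_smul]

/-- `D ⧸ ys D` has finite `G_C`-dimension over `R` if `D` has, for a sequence `ys` in a quotient
ring `S` of `R`. -/
lemma HasGCDimLE.of_isWeaklyRegular_of_surjective {C : Type u} [AddCommGroup C] [Module R C]
    {n : ℕ} (h : HasGCDimLE R C W n) {ys : List S} (hys : IsWeaklyRegular W ys) :
    HasGCDimLE R C (W ⧸ (Ideal.ofList ys • ⊤ : Submodule S W)) (n + ys.length) := by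
  obtain ⟨xs, rfl⟩ : ∃ xs : List R, xs.map (algebraMap R S) = ys := List.map_surjective_iff.2 hRS ys
  rw [isWeaklyRegular_map_algebraMap_iff] at hys
  rw [List.length_map]
  refine (h.of_isWeaklyRegular xs hys).of_linearEquiv ((Submodule.quotEquivOfEq _ _ ?_).trans
    (Submodule.Quotient.restrictScalarsEquiv R
      (Ideal.ofList (xs.map (algebraMap R S)) • ⊤ : Submodule S W)))
  rw [← Ideal.map_ofList, Ideal.smul_restrictScalars, Submodule.restrictScalars_top]

end QuotientRing

/-! ### Cohen–Macaulay modules and modules of finite length. -/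

section CohenMacaulay

open IsLocalRing RingTheory.Sequence

variable {R : Type u} [CommRing R] [IsLocalRing R] [IsNoetherianRing R]
  {M : Type u} [AddCommGroup M] [Module R M]

omit [IsNoetherianRing R] in
lemma IsFiniteLength.supportDim_eq_zero [Nontrivial M] (hM : IsFiniteLength R M) :
    Module.supportDim R M = 0 := by
  have := Module.Finite.of_isFiniteLength hM
  obtain ⟨n, hn⟩ := hM.exists_pow_smul_eq_zero (M := ModuleCat.of R M)
  have hsub : Subsingleton (Module.support R M) := by
    refine ⟨fun p q => Subtype.ext ?_⟩
    have key (p : PrimeSpectrum R) (hp : p ∈ Module.support R M) : p = closedPoint R := by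
      rw [Module.support_eq_zeroLocus, PrimeSpectrum.mem_zeroLocus] at hp
      exact PrimeSpectrum.ext ((le_maximalIdeal p.2.ne_top).antisymm
        (p.2.le_of_pow_le (hn.trans hp)))
    rw [key _ p.2, key _ q.2]
  have : Nonempty (Module.support R M) := (Module.nonempty_support_iff.2 ‹_›).to_subtype
  exact Order.krullDim_eq_zero

/-- Modules of finite length with one-dimensional socle are Cohen–Macaulay of type one. -/
lemma IsFiniteLength.isCohenMacaulayModule [hM' : Nontrivial M] (hM : IsFiniteLength R M)
    (hsoc : Module.length R (ResidueField R →ₗ[R] M) = 1) :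
    IsCohenMacaulayModule R M ∧ moduleType R M = 1 := by
  have := Module.Finite.of_isFiniteLength hM
  have hnt := hM.nontrivial_linearMap (M := ModuleCat.of R M)
  have hd : moduleDepth R M = (0 : ℕ) :=
    moduleDepth_eq M (fun i hi => absurd hi (Nat.not_lt_zero i))
      (Ext.zeroEquivLinearMap (ResidueField R) M).toEquiv.nontrivial
  refine ⟨⟨this, hM', ?_⟩, ?_⟩
  · rw [hd, hM.supportDim_eq_zero]
    rfl
  · rw [moduleType_eq_one_iff M hd, (Ext.zeroEquivLinearMap (ResidueField R) M).length_eq, hsoc]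

/-- A Cohen–Macaulay module modulo a maximal regular sequence. -/
lemma IsCohenMacaulayModule.exists_isRegular (h : IsCohenMacaulayModule R M) :
    ∃ rs : List R, IsRegular M rs ∧
      IsFiniteLength R (M ⧸ (Ideal.ofList rs • ⊤ : Submodule R M)) ∧
      (moduleType R M = 1 →
        Module.length R (ResidueField R →ₗ[R] M ⧸ (Ideal.ofList rs • ⊤ : Submodule R M)) = 1) := by
  have := h.finite
  have := h.nontrivial
  obtain ⟨rs, -, hreg, hd, -, -, ⟨e⟩⟩ := exists_isRegular_moduleDepth_eq (R := R) M
  refine ⟨rs, hreg, ?_, fun ht => ?_⟩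
  · have h1 := Module.supportDim_add_length_eq_supportDim_of_isRegular rs hreg
    have := hreg.quot_ofList_smul_nontrivial ⊤
    -- The dimension drops by the length of the sequence, which is the depth and hence the whole
    -- dimension.
    have h0 : Module.supportDim R (M ⧸ (Ideal.ofList rs • ⊤ : Submodule R M)) = 0 := by
      rw [← h.depth_eq_dim, hd] at h1
      generalize Module.supportDim R (M ⧸ (Ideal.ofList rs • ⊤ : Submodule R M)) = x at h1
      have h1' : x + ((rs.length : ℕ∞) : WithBot ℕ∞) = ((rs.length : ℕ∞) : WithBot ℕ∞) := h1
      induction x with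
      | bot => exact absurd h1' (by simp)
      | coe a =>
        norm_cast at h1' ⊢
        induction a with
        | top => exact absurd h1' (by simp)
        | coe a =>
          norm_cast at h1' ⊢
          omega
    refine isFiniteLength_of_support_subset _ ?_
    rw [support_of_supportDim_eq_zero R _ h0, PrimeSpectrum.zeroLocus_eq_singleton]
    exact subset_rfl
  · rw [← e.length_eq]
    exact (moduleType_eq_one_iff M hd).1 ht

end CohenMacaulay

/-! ### Dualizing modules along ring isomorphisms. -/

section Transfer

variable {R S : Type u} [CommRing R] [CommRing S] {C D : Type u} [AddCommGroup C] [Module R C]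
  [AddCommGroup D] [Module S D]

attribute [local instance] RingHomInvPair.of_ringEquiv in
lemma IsDualizing.of_ringEquiv (σ : R ≃+* S) (e : C ≃+ D)
    (he : ∀ (r : R) (x : C), e (r • x) = σ r • e x) (h : IsDualizing R C) : IsDualizing S D where
  semidualizing :=
    { finite := by
        have := h.semidualizing.finite
        let f : C →ₛₗ[RingHomClass.toRingHom σ] D := { e with map_smul' := he }
        exact Module.Finite.of_surjective f e.surjective
      homothety_bijective := by
        refine ⟨fun s t hst => ?_, fun f => ?_⟩
        · refine σ.symm.injective (h.semidualizing.homothety_bijective.1 (LinearMap.ext fun x => ?_))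
          refine e.injective ?_
          change e (σ.symm s • x) = e (σ.symm t • x)
          rw [he, he, RingEquiv.apply_symm_apply, RingEquiv.apply_symm_apply]
          exact LinearMap.congr_fun hst (e x)
        · let g : C →ₗ[R] C :=
            { toFun := fun x => e.symm (f (e x))
              map_add' := fun x y => by rw [map_add, map_add, map_add]
              map_smul' := fun r x => by
                rw [he, map_smul, AddEquiv.symm_apply_eq, RingHom.id_apply, he,
                  AddEquiv.apply_symm_apply] }
          obtain ⟨r, hr⟩ := h.semidualizing.homothety_bijective.2 g
          refine ⟨σ r, LinearMap.ext fun y => ?_⟩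
          obtain ⟨x, rfl⟩ := e.surjective y
          change σ r • e x = f (e x)
          rw [← he, ← AddEquiv.eq_symm_apply]
          exact LinearMap.congr_fun hr x
      ext_eq_zero := fun i hi => by
        have := h.semidualizing.ext_eq_zero i hi
        -- Restriction of scalars along σ is an equivalence, so it is injective on Ext and carries D
        -- to a copy of C.
        let F := (ModuleCat.restrictScalarsEquivalenceOfRingEquiv σ).functor
        let ε : C ≃ₗ[R] F.obj (ModuleCat.of S D) := { e with map_smul' := he }
        have h1 := (Ext.congrLeft ε.symm (ModuleCat.of R C) i).symm.subsingleton
        have h2 : Subsingleton (Ext (F.obj (ModuleCat.of S D)) (F.obj (ModuleCat.of S D)) i) :=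
          (Ext.congrRight (F.obj (ModuleCat.of S D)) ε.symm i).subsingleton
        exact (F.mapExt_bijective_of_preservesProjectiveObjects (ModuleCat.of S D)
          (ModuleCat.of S D) i).1.subsingleton }
  injectiveDimension_lt_top := by
    let e' : C ≃ₛₗ[RingHomClass.toRingHom σ] D := { e with map_smul' := he }
    rw [← ModuleCat.injectiveDimension_eq_of_semiLinearEquiv σ (M := ModuleCat.of R C)
      (N := ModuleCat.of S D) e']
    exact h.injectiveDimension_lt_top

/-- A dualizing module, seen over the trivial quotient ring. -/
lemma IsDualizing.quotient_bot (h : IsDualizing R C) :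
    IsDualizing (R ⧸ (⊥ : Ideal R)) (C ⧸ (⊥ : Ideal R) • (⊤ : Submodule R C)) := by
  let σ : R ≃+* R ⧸ (⊥ : Ideal R) := (RingEquiv.quotientBot R).symm
  let e : C ≃ₗ[R] C ⧸ (⊥ : Ideal R) • (⊤ : Submodule R C) :=
    (Submodule.quotEquivOfEqBot _ (Submodule.bot_smul _)).symm
  exact h.of_ringEquiv σ e.toAddEquiv e.map_smul

end Transfer

/-! ### The equivalences. -/

section Main

open IsLocalRing RingTheory.Sequence

variable {R : Type u} [CommRing R] [IsNoetherianRing R] [IsLocalRing R]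
  {C : Type u} [AddCommGroup C] [Module R C]

lemma IsSemidualizing.exists_isCohenMacaulayModule (hC : IsSemidualizing R C) {I : Ideal R}
    (hI : I ≠ ⊤) {n : ℕ} (h : HasGCDimLE R C (I • (⊤ : Submodule R C) : Submodule R C) n)
    (hd : IsDualizing (R ⧸ I) (C ⧸ I • (⊤ : Submodule R C))) :
    ∃ M : ModuleCat.{u} R, IsCohenMacaulayModule R M ∧ moduleType R M = 1 ∧ gcDim R C M < ⊤ := by
  have : Nontrivial (R ⧸ I) := Ideal.Quotient.nontrivial_iff.2 hI
  have hsurj : Function.Surjective (algebraMap R (R ⧸ I)) := Ideal.Quotient.mk_surjective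
  have : IsLocalRing (R ⧸ I) := .of_surjective' _ hsurj
  obtain ⟨ys, -, hys, hfl, hsoc⟩ := hd.exists_isRegular
  -- C is itself totally C-reflexive, so C/IC has finite G_C-dimension as soon as IC has; dividing
  -- by the lifted sequence preserves this.
  have hG := (HasGCDimLE.of_exact (Submodule.injective_subtype _) (Submodule.mkQ_surjective _)
    (LinearMap.exact_subtype_mkQ _) hC.isTotallyReflexive h).of_isWeaklyRegular_of_surjective
      hsurj hys.toIsWeaklyRegular
  have := hys.quot_ofList_smul_nontrivial ⊤
  obtain ⟨h1, h2⟩ := (hfl.of_surjective_algebraMap hsurj).isCohenMacaulayModule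
    ((length_residueField_linearMap_of_surjective hsurj).trans hsoc)
  exact ⟨ModuleCat.of R _, h1, h2, gcDim_lt_top_iff.2 ⟨_, hG⟩⟩

/-- A Cohen–Macaulay module of finite `G_C`-dimension, modulo a maximal regular sequence. -/
lemma IsCohenMacaulayModule.exists_isFiniteLength [Module.Finite R C] {t : ℕ}
    (hC : ∀ i < t, Subsingleton (Ext (ModuleCat.of R (ResidueField R)) (ModuleCat.of R C) i))
    (hC' : Nontrivial (Ext (ModuleCat.of R (ResidueField R)) (ModuleCat.of R C) t))
    {M : Type u} [AddCommGroup M] [Module R M] (hM : IsCohenMacaulayModule R M)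
    (h : gcDim R C M < ⊤) :
    ∃ N : ModuleCat.{u} R, Nontrivial N ∧ IsFiniteLength R N ∧ HasReflexiveResolution R C t N ∧
      (moduleType R M = 1 → Module.length R (ResidueField R →ₗ[R] N) = 1) := by
  obtain ⟨n, hn⟩ := gcDim_lt_top_iff.1 h
  obtain ⟨rs, hrs, hfl, hsoc⟩ := hM.exists_isRegular
  have := hM.finite
  exact ⟨ModuleCat.of R (M ⧸ (Ideal.ofList rs • ⊤ : Submodule R M)),
    hrs.quot_ofList_smul_nontrivial ⊤, hfl,
    (hn.of_isWeaklyRegular rs hrs.toIsWeaklyRegular).hasReflexiveResolution.of_depth hC hC', hsoc⟩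

end Main

theorem theorem3p4 (R : Type u) [CommRing R] [IsNoetherianRing R] [IsLocalRing R]
    (C : Type u) [AddCommGroup C] [Module R C] (hC : IsSemidualizing R C) :
    [IsDualizing R C,
      ∃ 𝔞 : Ideal R, 𝔞 ≠ ⊤ ∧
        gcDim R C (𝔞 • (⊤ : Submodule R C) : Submodule R C) < ⊤ ∧
        IsDualizing (R ⧸ 𝔞) (C ⧸ 𝔞 • (⊤ : Submodule R C)),
      ∃ M : ModuleCat.{u} R,
        IsCohenMacaulayModule R M ∧ moduleType R M = 1 ∧ gcDim R C M < ⊤,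
      moduleType R C = 1 ∧
        ∃ M : ModuleCat.{u} R, IsCohenMacaulayModule R M ∧ gcDim R C M < ⊤].TFAE := by
  have := hC.finite
  have := hC.nontrivial
  obtain ⟨rs, -, -, hd, h0, hnt, -⟩ := exists_isRegular_moduleDepth_eq (R := R) C
  tfae_have 1 → 2 := fun h => by
    have : Subsingleton ((⊥ : Ideal R) • (⊤ : Submodule R C) : Submodule R C) := by
      rw [Submodule.bot_smul]
      infer_instance
    exact ⟨⊥, bot_ne_top, gcDim_lt_top_iff.2 ⟨0, .of_subsingleton⟩, h.quotient_bot⟩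
  tfae_have 2 → 3 := fun ⟨I, hI, h, hd⟩ =>
    have ⟨_, hn⟩ := gcDim_lt_top_iff.1 h
    hC.exists_isCohenMacaulayModule hI hn hd
  tfae_have 3 → 4 := fun ⟨M, hM, ht, h⟩ => by
    obtain ⟨N, -, -, hN, hsoc⟩ := hM.exists_isFiniteLength h0 hnt h
    exact ⟨(moduleType_eq_one_iff C hd).2 (hN.length_ext_eq_one h0 hnt (hsoc ht)), M, hM, h⟩
  tfae_have 4 → 1 := fun ⟨ht, M, hM, h⟩ => by
    obtain ⟨N, hN', hfl, hN, -⟩ := hM.exists_isFiniteLength h0 hnt h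
    exact ⟨hC, injectiveDimension_lt_top_of_residueField fun i hi =>
      hN.subsingleton_ext_residueField h0 hfl ((moduleType_eq_one_iff C hd).1 ht) i hi⟩
  tfae_finish
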